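/- **Conventions.** Algorithms are randomized: they are programs for a random access machine with integer registers and integer memory cells that can toss fair coins. Operations are addition, subtraction, multiplication, integer division, memory access and tests for positivity, and each is charged one unit plus the bit length of the integers involved (logarithmic cost). An algorithm solves a decision problem in time $T$ if on every instance $x$ it halts within cost $T(x)$ for all outcomes of its coin tosses and answers correctly with probability at least $2/3$. - *2-sparse linear regression (2-SLR) in the Euclidean norm.* Given positive integers $d,n$, a matrix $\mathbf A\in\mathbb Q^{d\times n}$, a vector $\mathbf b\in\mathbb Q^{d}$ and a number $\delta\in\mathbb Q$, $\delta>0$ (each number written as numerator and denominator), decide whether there is a vector $\mathbf x\in\mathbb R^n$ with at most $2$ nonzero coordinates such that $\|\mathbf A\mathbf x-\mathbf b\|_2\le\delta$. Let $B$ be the largest bit length of a numerator or denominator occurring in $\mathbf A$, $\mathbf b$, $\delta$. - *Orthogonal Vectors (OV).* Given positive integers $n,d$ and vectors $\mathbf u_1,\dots,\mathbf u_n,\mathbf v_1,\dots,\mathbf v_n\in\{0,1\}^d$, decide whether there are $i,j$ with $\langle \mathbf u_i,\mathbf v_j\rangle=\sum_{l=1}^d \mathbf u_i[l]\,\mathbf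 v_j[l]=0$. The *Orthogonal Vectors Hypothesis* states that for no $\varepsilon>0$ and no constants $C,c$ there is a randomized algorithm that solves OV in time $C\,n^{2-\varepsilon}d^{c}$. - *$k$-SAT.* Given a CNF formula on $n$ variables, without repeated clauses, each clause of size at most $k$, decide whether it is satisfiable. The *Strong Exponential Time Hypothesis (SETH)* states that for every $\varepsilon>0$ there is an integer $k\ge 3$ such that no randomized algorithm solves $k$-SAT on $n$ variables in time $O(2^{(1-\varepsilon)n})$. **Corollary.** Suppose that for some $\varepsilon>0$ and some constants $C,c$ there is a (possibly randomized) algorithm that solves 2-SLR in the Euclidean norm in time $C\,n^{2-\varepsilon}(dB)^{c}$ (in particular, suppose it runs in time $n^{2-\varepsilon}\,\mathrm{poly}(d)$). Then the Orthogonal Vectors Hypothesis is false and SETH is false. -/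

import Mathlib

open scoped ENNReal

namespace FineGrained

noncomputable section

/-! ### Random access machines with logarithmic cost

Algorithms are programs for a random access machine, written in structured form.  The machine has
registers and a memory, all holding integers; memory is addressed by integers.  Every arithmetic
operation, every memory access and every test is charged one unit plus the number of bits of the
integers it handles.  A program can toss fair coins. -/

/-- The number of bits of (the absolute value of) an integer. -/
def bitLen (z : ℤ) : ℕ := z.natAbs.size

/-- A state of the machine: registers, memory and the coins that have not been tossed yet. -/
structure State where
  reg : ℕ → ℤ
  mem : ℤ → ℤ
  coins : ℕ → Bool

/-- Expressions. `load e` is the content of the memory cell whose address is the value of `e`;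
`div` is integer division. -/
inductive Expr where
  | const : ℤ → Expr
  | reg : ℕ → Expr
  | load : Expr → Expr
  | add : Expr → Expr → Expr
  | sub : Expr → Expr → Expr
  | mul : Expr → Expr → Expr
  | div : Expr → Expr → Expr

/-- The value of an expression. -/
def Expr.val (s : State) : Expr → ℤ
  | .const z => z
  | .reg r => s.reg r
  | .load e => s.mem (e.val s)
  | .add e f => e.val s + f.val s
  | .sub e f => e.val s - f.val s
  | .mul e f => e.val s * f.val s
  | .div e f => e.val s / f.val s

/-- The logarithmic cost of evaluating an expression: every node is charged one unit plus the bit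
length of its value (the operands and the addresses are the values of the nodes below it). -/
def Expr.cost (s : State) : Expr → ℕ
  | .const z => 1 + bitLen z
  | .reg r => 1 + bitLen (s.reg r)
  | .load e => e.cost s + (1 + bitLen ((Expr.load e).val s))
  | .add e f => e.cost s + f.cost s + (1 + bitLen ((Expr.add e f).val s))
  | .sub e f => e.cost s + f.cost s + (1 + bitLen ((Expr.sub e f).val s))
  | .mul e f => e.cost s + f.cost s + (1 + bitLen ((Expr.mul e f).val s))
  | .div e f => e.cost s + f.cost s + (1 + bitLen ((Expr.div e f).val s))

/-- Programs. -/
inductive Prog where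
  | skip : Prog
  /-- `assign r e` puts the value of `e` into register `r`. -/
  | assign : ℕ → Expr → Prog
  /-- `store e f` puts the value of `f` into the memory cell with address the value of `e`. -/
  | store : Expr → Expr → Prog
  /-- `flip r` tosses a fair coin and puts the outcome, 0 or 1, into register `r`. -/
  | flip : ℕ → Prog
  | seq : Prog → Prog → Prog
  /-- `ite e p q` runs `p` if the value of `e` is positive, and `q` otherwise. -/
  | ite : Expr → Prog → Prog → Prog
  /-- `loop e p` runs `p` as long as the value of `e` is positive. -/
  | loop : Expr → Prog → Prog

/-- `Exec p s t s'`: the program `p`, started in the state `s`, halts in the state `s'` after a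
computation of total cost `t`. -/
inductive Exec : Prog → State → ℕ → State → Prop where
  | skip (s : State) : Exec .skip s 1 s
  | assign (s : State) (r : ℕ) (e : Expr) :
      Exec (.assign r e) s (e.cost s + 1)
        { s with reg := Function.update s.reg r (e.val s) }
  | store (s : State) (e f : Expr) :
      Exec (.store e f) s (e.cost s + f.cost s + 1)
        { s with mem := Function.update s.mem (e.val s) (f.val s) }
  | flip (s : State) (r : ℕ) :
      Exec (.flip r) s 1
        { s with
          reg := Function.update s.reg r (if s.coins 0 then 1 else 0)
          coins := fun i => s.coins (i + 1) }
  | seq {p q : Prog} {s s' s'' : State} {t t' : ℕ} :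
      Exec p s t s' → Exec q s' t' s'' → Exec (.seq p q) s (t + t') s''
  | ite_pos {e : Expr} {p q : Prog} {s s' : State} {t : ℕ} :
      0 < e.val s → Exec p s t s' → Exec (.ite e p q) s (e.cost s + 1 + t) s'
  | ite_nonpos {e : Expr} {p q : Prog} {s s' : State} {t : ℕ} :
      e.val s ≤ 0 → Exec q s t s' → Exec (.ite e p q) s (e.cost s + 1 + t) s'
  | loop_pos {e : Expr} {p : Prog} {s s' s'' : State} {t t' : ℕ} :
      0 < e.val s → Exec p s t s' → Exec (.loop e p) s' t' s'' →
      Exec (.loop e p) s (e.cost s + 1 + t + t') s''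
  | loop_nonpos {e : Expr} {p : Prog} {s : State} :
      e.val s ≤ 0 → Exec (.loop e p) s (e.cost s + 1) s

/-- The initial state: the input stands in the memory cells `0, 1, 2, …`, and every other memory
cell and every register is `0`. -/
def initState (input : List ℤ) (ω : ℕ → Bool) : State where
  reg := fun _ => 0
  mem := fun a => if 0 ≤ a then input.getD a.toNat 0 else 0
  coins := ω

/-- The law of a sequence of independent fair coin tosses. -/
def coinMeasure : MeasureTheory.Measure (ℕ → Bool) :=
  MeasureTheory.Measure.infinitePi fun _ => (PMF.uniformOfFintype Bool).toMeasure

/-- A decision problem: instances, their encoding as a list of integers, and the YES instances. -/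
structure DecisionProblem where
  Inst : Type
  encode : Inst → List ℤ
  yes : Inst → Prop

/-- `P.SolvableInTime T`: some randomized algorithm solves `P` in time `T`.  On every instance `x`
it halts within cost `T x` for all outcomes of the coin tosses, and its answer (YES if register 0
is positive at the end, NO otherwise) is correct with probability at least `2/3`. -/
def DecisionProblem.SolvableInTime (P : DecisionProblem) (T : P.Inst → ℝ) : Prop :=
  ∃ p : Prog, ∀ x : P.Inst,
    (∀ ω : ℕ → Bool, ∃ (t : ℕ) (s : State),
      Exec p (initState (P.encode x) ω) t s ∧ (t : ℝ) ≤ T x) ∧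
    (2 / 3 : ℝ≥0∞) ≤ coinMeasure {ω | ∃ (t : ℕ) (s : State),
      Exec p (initState (P.encode x) ω) t s ∧ (0 < s.reg 0 ↔ P.yes x)}

/-! ### Sparse linear regression in the Euclidean norm -/

/-- An instance of sparse linear regression, with finitely represented (rational) numbers: a
`d × n` design matrix, a target vector and an error bound. -/
structure SLRInstance where
  d : ℕ
  n : ℕ
  d_pos : 0 < d
  n_pos : 0 < n
  A : Matrix (Fin d) (Fin n) ℚ
  b : Fin d → ℚ
  δ : ℚ
  δ_pos : 0 < δ

/-- The number of bits of the numerator or of the denominator of `q`, whichever is larger. -/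
def ratBits (q : ℚ) : ℕ := max (bitLen q.num) (bitLen q.den)

/-- The largest bit length of a number in the instance. -/
def SLRInstance.bits (I : SLRInstance) : ℕ :=
  max (ratBits I.δ) (max (Finset.univ.sup fun i => ratBits (I.b i))
    (Finset.univ.sup fun i => Finset.univ.sup fun j => ratBits (I.A i j)))

/-- A rational number is written as its numerator followed by its denominator. -/
def encodeRat (q : ℚ) : List ℤ := [q.num, (q.den : ℤ)]

/-- The dimensions, the error bound, the target vector, and the design matrix column by column. -/
def SLRInstance.encode (I : SLRInstance) : List ℤ :=
  [(I.d : ℤ), (I.n : ℤ)] ++ encodeRat I.δ ++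
    (List.ofFn fun i => encodeRat (I.b i)).flatten ++
    (List.ofFn fun j => (List.ofFn fun i => encodeRat (I.A i j)).flatten).flatten

/-- Some real vector `x` with at most `k` nonzero coordinates has `‖A x - b‖₂ ≤ δ`. -/
def SLRInstance.IsYes (k : ℕ) (I : SLRInstance) : Prop :=
  ∃ x : Fin I.n → ℝ, {j | x j ≠ 0}.ncard ≤ k ∧
    ‖(WithLp.toLp 2 ((I.A.map fun q : ℚ => (q : ℝ)).mulVec x - fun i => (I.b i : ℝ)) :
      EuclideanSpace ℝ (Fin I.d))‖ ≤ (I.δ : ℝ)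

/-- The `k`-sparse linear regression problem in the Euclidean norm. -/
def SLR (k : ℕ) : DecisionProblem where
  Inst := SLRInstance
  encode := SLRInstance.encode
  yes := SLRInstance.IsYes k

/-! ### Orthogonal vectors -/

/-- An instance of Orthogonal Vectors: two families of `n` vectors in `{0,1}^d`. -/
structure OVInstance where
  n : ℕ
  d : ℕ
  n_pos : 0 < n
  d_pos : 0 < d
  U : Fin n → Fin d → Bool
  V : Fin n → Fin d → Bool

/-- A `0/1` vector as a list of integers. -/
def encodeBits {d : ℕ} (u : Fin d → Bool) : List ℤ :=
  List.ofFn fun i => if u i then 1 else 0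

/-- The number of vectors, the dimension, the vectors of `U` and the vectors of `V`. -/
def OVInstance.encode (I : OVInstance) : List ℤ :=
  [(I.n : ℤ), (I.d : ℤ)] ++ (List.ofFn fun i => encodeBits (I.U i)).flatten ++
    (List.ofFn fun j => encodeBits (I.V j)).flatten

/-- Some `u` in `U` and some `v` in `V` have inner product `0`. -/
def OVInstance.IsYes (I : OVInstance) : Prop :=
  ∃ i j : Fin I.n, ∑ l : Fin I.d, (I.U i l).toNat * (I.V j l).toNat = 0

/-- The Orthogonal Vectors problem. -/
def OV : DecisionProblem where
  Inst := OVInstance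
  encode := OVInstance.encode
  yes := OVInstance.IsYes

/-- The Orthogonal Vectors Hypothesis: no randomized algorithm solves Orthogonal Vectors in time
`n ^ (2 - ε) * poly(d)` for a constant `ε > 0`. -/
def OVHypothesis : Prop :=
  ¬ ∃ ε : ℝ, 0 < ε ∧ ∃ (C : ℝ) (c : ℕ),
    OV.SolvableInTime fun I : OVInstance => C * (I.n : ℝ) ^ (2 - ε) * (I.d : ℝ) ^ c

/-! ### Satisfiability -/

/-- A CNF formula on the variables `0, …, n - 1`, all of whose clauses have size at most `k`: a
list, without repetition, of clauses; a clause is a list of literals; the literal `(i, true)` is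
the variable `i` and `(i, false)` is its negation. -/
structure KCNF (k : ℕ) where
  n : ℕ
  clauses : List (List (Fin n × Bool))
  nodup : clauses.Nodup
  size_le : ∀ c ∈ clauses, c.length ≤ k

/-- The literals on variable `i` are written as `i + 1` and `-(i + 1)`. -/
def encodeLit {n : ℕ} (l : Fin n × Bool) : ℤ :=
  if l.2 then ((l.1 : ℕ) : ℤ) + 1 else -(((l.1 : ℕ) : ℤ) + 1)

/-- The numbers of variables and of clauses, then every clause, preceded by its length. -/
def KCNF.encode {k : ℕ} (φ : KCNF k) : List ℤ :=
  [(φ.n : ℤ), (φ.clauses.length : ℤ)] ++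
    (φ.clauses.map fun c => (c.length : ℤ) :: c.map encodeLit).flatten

/-- Some assignment makes a literal true in every clause. -/
def KCNF.Satisfiable {k : ℕ} (φ : KCNF k) : Prop :=
  ∃ a : Fin φ.n → Bool, ∀ c ∈ φ.clauses, ∃ l ∈ c, a l.1 = l.2

/-- The `k`-SAT problem. -/
def KSAT (k : ℕ) : DecisionProblem where
  Inst := KCNF k
  encode := KCNF.encode
  yes := KCNF.Satisfiable

/-- The Strong Exponential Time Hypothesis: for every `ε > 0` there is `k ≥ 3` such that no
randomized algorithm solves `k`-SAT on `n` variables in time `O(2 ^ ((1 - ε) * n))`. -/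
def SETH : Prop :=
  ∀ ε : ℝ, 0 < ε → ∃ k : ℕ, 3 ≤ k ∧ ¬ ∃ C : ℝ,
    (KSAT k).SolvableInTime fun φ : KCNF k => C * (2 : ℝ) ^ ((1 - ε) * (φ.n : ℝ))

end

end FineGrained

/-!
For vectors `u`, `v` in `{0,1} ^ d`, each of the `d` terms `(4 u_l + 4 v_l - 2) ^ 2` is `4`, except
that it is `36` when `u_l = v_l = 1`; so the sum separates orthogonal pairs from the others. In the
regression instance the columns are the vectors `4 u_i` and `4 v_j`. Two further rows, of weight
`24 d`, force a `2`-sparse solution to use exactly one `u_i` and one `v_j`, with coefficients so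
close to `1` that the gap survives, and a last row with the constant error `d - 1` turns the bound
`4 d + (d - 1) ^ 2` into the square of `d + 1`. The instance has `2 n` columns, and both its
dimension and its bit lengths are `O(d)`.

For satisfiability, the variables are split into two halves, every assignment of a half becomes a
vector with a coordinate for each clause, which is `1` if the assignment does not satisfy the
clause, and satisfying assignments are the orthogonal pairs. Clauses of size at most `k` without
repetitions are polynomially many, so `2 ^ (n / 2)` vectors on each side give the exponent
`(1 - ε / 2) n` up to a polynomial factor, which costs a further `ε n / 4`.

Both reductions are carried out by programs that first move the input out of the way, then write
the new instance and erase everything else. The loops are analysed through invariants that describe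
all registers in terms of the loop counter.
-/

namespace FineGrained

/-! ### Bit lengths -/

theorem bitLen_le_iff {z : ℤ} {B : ℕ} : bitLen z ≤ B ↔ z.natAbs < 2 ^ B := Nat.size_le

theorem natAbs_lt_two_pow_bitLen (z : ℤ) : z.natAbs < 2 ^ bitLen z := bitLen_le_iff.1 le_rfl

theorem bitLen_add_le (a b : ℤ) : bitLen (a + b) ≤ bitLen a + bitLen b + 1 := by
  rw [bitLen_le_iff]
  calc (a + b).natAbs ≤ a.natAbs + b.natAbs := Int.natAbs_add_le a b
    _ < 2 ^ bitLen a + 2 ^ bitLen b :=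
      add_lt_add (natAbs_lt_two_pow_bitLen a) (natAbs_lt_two_pow_bitLen b)
    _ ≤ 2 ^ (bitLen a + bitLen b) + 2 ^ (bitLen a + bitLen b) := by
      gcongr <;> omega
    _ = 2 ^ (bitLen a + bitLen b + 1) := by ring

theorem bitLen_neg (a : ℤ) : bitLen (-a) = bitLen a := by simp [bitLen]

theorem bitLen_sub_le (a b : ℤ) : bitLen (a - b) ≤ bitLen a + bitLen b + 1 := by
  rw [sub_eq_add_neg, ← bitLen_neg b]
  exact bitLen_add_le a (-b)

theorem bitLen_mul_le (a b : ℤ) : bitLen (a * b) ≤ bitLen a + bitLen b := by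
  rw [bitLen_le_iff, Int.natAbs_mul, pow_add]
  exact Nat.mul_lt_mul'' (natAbs_lt_two_pow_bitLen a) (natAbs_lt_two_pow_bitLen b)

theorem bitLen_ediv_le (a b : ℤ) : bitLen (a / b) ≤ bitLen a := by
  rw [bitLen_le_iff]
  exact (Int.natAbs_ediv_le_natAbs a b).trans_lt (natAbs_lt_two_pow_bitLen a)

theorem ratBits_intCast_le {z : ℤ} {B : ℕ} (hB : 1 ≤ B) (hz : z.natAbs ≤ B) :
    ratBits (z : ℚ) ≤ B := by
  have hnum : bitLen z ≤ B := bitLen_le_iff.2 (hz.trans_lt Nat.lt_two_pow_self)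
  have hden : bitLen 1 ≤ B := bitLen_le_iff.2 (Nat.one_lt_two_pow (by omega))
  simpa [ratBits] using ⟨hnum, hden⟩

/-! ### Weights of programs -/

/-- All integers in the state have at most `B` bits. -/
def HasBits (B : ℕ) (s : State) : Prop :=
  (∀ r, bitLen (s.reg r) ≤ B) ∧ ∀ a, bitLen (s.mem a) ≤ B

/-- All integers in the state are at most `M` in absolute value. -/
def Small (M : ℕ) (s : State) : Prop :=
  (∀ r, (s.reg r).natAbs ≤ M) ∧ ∀ a, (s.mem a).natAbs ≤ M

/-- A constant such that evaluating the expression in a state whose integers have `B ≥ 1` bits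
costs at most `weight * B`. -/
def Expr.weight : Expr → ℕ
  | .const z => 1 + bitLen z
  | .reg _ => 2
  | .load e => e.weight + 2
  | .add e f | .sub e f | .mul e f | .div e f => 2 * (e.weight + f.weight) + 2

/-- A constant that measures the cost of a program. A program without loops and coin tosses that
is run in a state whose integers have `B ≥ 1` bits costs at most `weight * B`, and also leaves
integers of at most `weight * B` bits, whence the product in the case of `seq`. For a loop, this
is the factor for a single iteration. -/
def Prog.weight : Prog → ℕ
  | .skip | .flip _ => 1
  | .assign _ e => e.weight + 1
  | .store e f => e.weight + f.weight + 1
  | .seq p q => p.weight + q.weight * p.weight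
  | .ite e p q => e.weight + 1 + p.weight + q.weight
  | .loop e p => p.weight + (e.weight + 1)

theorem HasBits.mono {B B' : ℕ} {s : State} (h : HasBits B s) (hB : B ≤ B') : HasBits B' s :=
  ⟨fun r => (h.1 r).trans hB, fun a => (h.2 a).trans hB⟩

theorem Small.hasBits {M : ℕ} {s : State} (h : Small M s) : HasBits M.size s :=
  ⟨fun r => Nat.size_le_size (h.1 r), fun a => Nat.size_le_size (h.2 a)⟩

theorem Expr.bitLen_val_le_cost (s : State) (e : Expr) : bitLen (e.val s) ≤ e.cost s := by
  cases e <;> simp only [Expr.cost, Expr.val] <;> omega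

theorem Expr.cost_le_weight_mul {s : State} {B : ℕ} (hB : 1 ≤ B) (h : HasBits B s) (e : Expr) :
    e.cost s ≤ e.weight * B := by
  induction e with
  | const z => exact Nat.le_mul_of_pos_right _ hB
  | reg r => have := h.1 r; simp only [Expr.cost, Expr.weight]; omega
  | load e ih => have := h.2 (e.val s); simp only [Expr.cost, Expr.weight, Expr.val, add_mul]; omega
  | add e f ihe ihf =>
    have := bitLen_add_le (e.val s) (f.val s)
    have := e.bitLen_val_le_cost s
    have := f.bitLen_val_le_cost s
    simp only [Expr.cost, Expr.weight, Expr.val, add_mul, mul_assoc, mul_add]; omega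
  | sub e f ihe ihf =>
    have := bitLen_sub_le (e.val s) (f.val s)
    have := e.bitLen_val_le_cost s
    have := f.bitLen_val_le_cost s
    simp only [Expr.cost, Expr.weight, Expr.val, add_mul, mul_assoc, mul_add]; omega
  | mul e f ihe ihf =>
    have := bitLen_mul_le (e.val s) (f.val s)
    have := e.bitLen_val_le_cost s
    have := f.bitLen_val_le_cost s
    simp only [Expr.cost, Expr.weight, Expr.val, add_mul, mul_assoc, mul_add]; omega
  | div e f ihe ihf =>
    have := bitLen_ediv_le (e.val s) (f.val s)
    have := e.bitLen_val_le_cost s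
    simp only [Expr.cost, Expr.weight, Expr.val, add_mul, mul_assoc, mul_add]; omega

theorem Prog.one_le_weight (p : Prog) : 1 ≤ p.weight := by
  induction p <;> simp only [Prog.weight] <;> omega

/-! ### Straight-line programs -/

/-- The state with the value `v` put into register `r`. -/
def State.setReg (s : State) (r : ℕ) (v : ℤ) : State :=
  { s with reg := Function.update s.reg r v }

/-- The state with the value `v` put into the memory cell `a`. -/
def State.setMem (s : State) (a v : ℤ) : State :=
  { s with mem := Function.update s.mem a v }

/-- Programs without loops and coin tosses. -/
def Prog.IsBlock : Prog → Prop
  | .skip | .assign _ _ | .store _ _ => True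
  | .seq p q | .ite _ p q => p.IsBlock ∧ q.IsBlock
  | .flip _ | .loop _ _ => False

/-- The final state of a program without loops and coin tosses; loops and coin tosses are
ignored. -/
def Prog.eval : Prog → State → State
  | .assign r e, s => s.setReg r (e.val s)
  | .store e f, s => s.setMem (e.val s) (f.val s)
  | .seq p q, s => q.eval (p.eval s)
  | .ite e p q, s => if 0 < e.val s then p.eval s else q.eval s
  | .skip, s | .flip _, s | .loop _ _, s => s

theorem HasBits.setReg {B : ℕ} {s : State} (h : HasBits B s) (r : ℕ) {v : ℤ} (hv : bitLen v ≤ B) :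
    HasBits B (s.setReg r v) := by
  refine ⟨fun r' => ?_, h.2⟩
  simp only [State.setReg, Function.update_apply]
  split_ifs
  exacts [hv, h.1 r']

theorem HasBits.setMem {B : ℕ} {s : State} (h : HasBits B s) (a : ℤ) {v : ℤ} (hv : bitLen v ≤ B) :
    HasBits B (s.setMem a v) := by
  refine ⟨h.1, fun a' => ?_⟩
  simp only [State.setMem, Function.update_apply]
  split_ifs
  exacts [hv, h.2 a']

theorem Prog.IsBlock.exec_eval {p : Prog} (hp : p.IsBlock) {s : State} {B : ℕ} (hB : 1 ≤ B)
    (h : HasBits B s) :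
    (∃ t, Exec p s t (p.eval s) ∧ t ≤ p.weight * B) ∧ HasBits (p.weight * B) (p.eval s) := by
  induction p generalizing s B with
  | flip | loop => exact hp.elim
  | skip =>
    simp only [Prog.weight, Prog.eval, one_mul]
    exact ⟨⟨1, .skip s, hB⟩, h⟩
  | assign r e =>
    have hc := e.cost_le_weight_mul hB h
    have hv := e.bitLen_val_le_cost s
    simp only [Prog.weight, add_mul, one_mul]
    exact ⟨⟨_, .assign s r e, by omega⟩, (h.mono (by omega)).setReg r (by omega)⟩
  | store e f =>
    have he := e.cost_le_weight_mul hB h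
    have hf := f.cost_le_weight_mul hB h
    have hv := f.bitLen_val_le_cost s
    simp only [Prog.weight, add_mul, one_mul]
    exact ⟨⟨_, .store s e f, by omega⟩, (h.mono (by omega)).setMem _ (by omega)⟩
  | seq p q ihp ihq =>
    obtain ⟨⟨t, hpt, ht⟩, hbits⟩ := ihp hp.1 hB h
    obtain ⟨⟨t', hqt, ht'⟩, hbits'⟩ := ihq hp.2 (Nat.mul_pos p.one_le_weight hB) hbits
    simp only [Prog.weight, add_mul, mul_assoc]
    exact ⟨⟨_, hpt.seq hqt, by omega⟩, hbits'.mono (by omega)⟩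
  | ite e p q ihp ihq =>
    have hc := e.cost_le_weight_mul hB h
    simp only [Prog.weight, Prog.eval, add_mul, one_mul]
    split_ifs with he
    · obtain ⟨⟨t, hpt, ht⟩, hbits⟩ := ihp hp.1 hB h
      exact ⟨⟨_, .ite_pos he hpt, by omega⟩, hbits.mono (by omega)⟩
    · obtain ⟨⟨t, hqt, ht⟩, hbits⟩ := ihq hp.2 hB h
      exact ⟨⟨_, .ite_nonpos (not_lt.1 he) hqt, by omega⟩, hbits.mono (by omega)⟩

/-! ### Running times -/

/-- Started in `s`, the program halts in `s'`, and its cost is that of at most `N` steps on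
integers of absolute value at most `M`, up to the weight of the program. -/
def Runs (M N : ℕ) (p : Prog) (s s' : State) : Prop :=
  ∃ t, Exec p s t s' ∧ t ≤ p.weight * (N * M.size)

section

variable {M N N' : ℕ} {p q : Prog} {s s' s'' : State}

theorem Runs.mono (h : Runs M N p s s') (hN : N ≤ N') : Runs M N' p s s' :=
  let ⟨t, hp, ht⟩ := h
  ⟨t, hp, ht.trans (by gcongr)⟩

theorem Runs.seq (hp : Runs M N p s s') (hq : Runs M N q s' s'') :
    Runs M N (.seq p q) s s'' := by
  obtain ⟨t, hp, ht⟩ := hp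
  obtain ⟨t', hq, ht'⟩ := hq
  refine ⟨_, hp.seq hq, ?_⟩
  calc t + t' ≤ p.weight * (N * M.size) + q.weight * (N * M.size) := add_le_add ht ht'
    _ ≤ p.weight * (N * M.size) + (q.weight * p.weight) * (N * M.size) := by
      gcongr
      exact Nat.le_mul_of_pos_right _ p.one_le_weight
    _ = _ := by rw [Prog.weight, add_mul]

theorem Runs.block (hp : p.IsBlock) (hM : 1 ≤ M) (h : Small M s) (hs : p.eval s = s') :
    Runs M 1 p s s' := by
  rw [Runs, one_mul, ← hs]
  exact (hp.exec_eval (Nat.size_pos.2 hM) h.hasBits).1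

theorem Small.guard_cost_le (hM : 1 ≤ M) (hN : 1 ≤ N) (h : Small M s) (e : Expr) :
    e.cost s + 1 ≤ (e.weight + 1) * (N * M.size) := by
  have hS : 1 ≤ M.size := Nat.size_pos.2 hM
  have hcost := e.cost_le_weight_mul hS h.hasBits
  calc e.cost s + 1 ≤ (e.weight + 1) * M.size := by rw [add_mul]; omega
    _ ≤ _ := by gcongr; exact Nat.le_mul_of_pos_left _ hN

theorem Runs.loop {e : Expr} (hM : 1 ≤ M) (hN : 1 ≤ N) (st : ℕ → State) (k : ℕ)
    (hpos : ∀ i < k, 0 < e.val (st i)) (hend : e.val (st k) ≤ 0)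
    (hsmall : ∀ i ≤ k, Small M (st i)) (hbody : ∀ i < k, Runs M N p (st i) (st (i + 1))) :
    Runs M ((k + 1) * N) (.loop e p) (st 0) (st k) := by
  have hguard := (hsmall 0 k.zero_le).guard_cost_le hM hN e
  induction k generalizing st with
  | zero =>
    refine ⟨_, .loop_nonpos hend, hguard.trans ?_⟩
    rw [zero_add, one_mul]
    exact Nat.mul_le_mul_right _ (Nat.le_add_left _ _)
  | succ k ih =>
    obtain ⟨t, hp, ht⟩ := hbody 0 k.succ_pos
    obtain ⟨t', hloop, ht'⟩ := ih (fun i => st (i + 1)) (fun i hi => hpos _ (by omega)) hend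
      (fun i hi => hsmall _ (by omega)) (fun i hi => hbody _ (by omega))
      ((hsmall 1 (by omega)).guard_cost_le hM hN e)
    refine ⟨_, .loop_pos (hpos 0 k.succ_pos) hp hloop, ?_⟩
    simp only [Prog.weight] at ht' ⊢
    linarith

end

/-! ### Reductions -/

theorem DecisionProblem.SolvableInTime.mono {P : DecisionProblem} {T T' : P.Inst → ℝ}
    (h : P.SolvableInTime T) (hT : ∀ x, T x ≤ T' x) : P.SolvableInTime T' := by
  obtain ⟨p, hp⟩ := h
  refine ⟨p, fun x => ⟨fun ω => ?_, (hp x).2⟩⟩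
  obtain ⟨t, s, hexec, ht⟩ := (hp x).1 ω
  exact ⟨t, s, hexec, ht.trans (hT x)⟩

theorem DecisionProblem.SolvableInTime.of_reduction {P Q : DecisionProblem} {T : Q.Inst → ℝ}
    (hQ : Q.SolvableInTime T) (f : P.Inst → Q.Inst) (hf : ∀ x, Q.yes (f x) ↔ P.yes x) {R : Prog}
    {M N : P.Inst → ℕ}
    (hR : ∀ x ω, Runs (M x) (N x) R (initState (P.encode x) ω) (initState (Q.encode (f x)) ω)) :
    P.SolvableInTime fun x => R.weight * (N x * (M x).size) + T (f x) := by
  obtain ⟨p, hp⟩ := hQ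
  refine ⟨.seq R p, fun x => ⟨fun ω => ?_, ?_⟩⟩
  · obtain ⟨t, s, hexec, ht⟩ := (hp (f x)).1 ω
    obtain ⟨t', hred, ht'⟩ := hR x ω
    refine ⟨_, s, hred.seq hexec, ?_⟩
    rw [Nat.cast_add]
    exact add_le_add (by exact_mod_cast ht') ht
  · refine (hp (f x)).2.trans (MeasureTheory.measure_mono ?_)
    rintro ω ⟨t, s, hexec, hs⟩
    obtain ⟨t', hred, -⟩ := hR x ω
    exact ⟨_, s, hred.seq hexec, hs.trans (hf x)⟩

/-! ### Tapes -/

/-- The list as a sequence, continued by zeros. -/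
def padded (x : List ℤ) : ℕ → ℤ := fun k => x.getD k 0

/-- The memory with `f` in the cells `-1, -2, -3, …` and `g` in the cells `0, 1, 2, …`. -/
def splitMem (f g : ℕ → ℤ) : ℤ → ℤ := fun a => if 0 ≤ a then g a.toNat else f (-1 - a).toNat

/-- The state with `l` in the registers `0, 1, 2, …`, with `f` in the memory cells `-1, -2, -3, …`
and `g` in the memory cells `0, 1, 2, …`. -/
def tapeState (l : List ℤ) (f g : ℕ → ℤ) (ω : ℕ → Bool) : State := ⟨padded l, splitMem f g, ω⟩

theorem initState_eq_tapeState (x : List ℤ) (ω : ℕ → Bool) :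
    initState x ω = tapeState [] 0 (padded x) ω := rfl

theorem natAbs_padded_le {M : ℕ} {x : List ℤ} (hx : ∀ v ∈ x, v.natAbs ≤ M) (k : ℕ) :
    (padded x k).natAbs ≤ M := by
  rcases lt_or_ge k x.length with hk | hk
  · simpa [padded, hk] using hx _ (List.getElem_mem hk)
  · simp [padded, hk]

theorem padded_eq_zero {x : List ℤ} {k : ℕ} (hk : x.length ≤ k) : padded x k = 0 := by
  simp [padded, hk]

theorem padded_set {x : List ℤ} {k : ℕ} (hk : k < x.length) (v : ℤ) :
    padded (x.set k v) = Function.update (padded x) k v := by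
  funext j
  simp only [padded, Function.update_apply]
  grind

theorem padded_concat (x : List ℤ) (v : ℤ) :
    padded (x ++ [v]) = Function.update (padded x) x.length v := by
  funext j
  simp only [padded, Function.update_apply]
  grind

theorem splitMem_natCast (f g : ℕ → ℤ) (k : ℕ) : splitMem f g k = g k := by simp [splitMem]

theorem splitMem_neg_one_sub (f g : ℕ → ℤ) (k : ℕ) : splitMem f g (-1 - k) = f k := by
  rw [splitMem, if_neg (by omega)]
  congr 1
  omega

theorem update_splitMem_natCast (f g : ℕ → ℤ) (k : ℕ) (v : ℤ) :
    Function.update (splitMem f g) k v = splitMem f (Function.update g k v) := by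
  funext a
  simp only [splitMem, Function.update_apply]
  split_ifs <;> first | rfl | omega

theorem update_splitMem_neg_one_sub (f g : ℕ → ℤ) (k : ℕ) (v : ℤ) :
    Function.update (splitMem f g) (-1 - k) v = splitMem (Function.update f k v) g := by
  funext a
  simp only [splitMem, Function.update_apply]
  split_ifs <;> first | rfl | omega

section

variable (l : List ℤ) (f g : ℕ → ℤ) (ω : ℕ → Bool)

@[simp]
theorem tapeState_reg (r : ℕ) : (tapeState l f g ω).reg r = l.getD r 0 := rfl

@[simp]
theorem tapeState_mem : (tapeState l f g ω).mem = splitMem f g := rfl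

variable {l} in
@[simp]
theorem tapeState_setReg {r : ℕ} (hr : r < l.length) (v : ℤ) :
    (tapeState l f g ω).setReg r v = tapeState (l.set r v) f g ω := by
  rw [tapeState, tapeState, padded_set hr, State.setReg]

@[simp]
theorem tapeState_setMem_natCast (k : ℕ) (v : ℤ) :
    (tapeState l f g ω).setMem k v = tapeState l f (Function.update g k v) ω := by
  rw [tapeState, tapeState, ← update_splitMem_natCast, State.setMem]

@[simp]
theorem tapeState_setMem_neg_one_sub (k : ℕ) (v : ℤ) :
    (tapeState l f g ω).setMem (-1 - k) v = tapeState l (Function.update f k v) g ω := by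
  rw [tapeState, tapeState, ← update_splitMem_neg_one_sub, State.setMem]

end

theorem Small.tapeState {M : ℕ} {l : List ℤ} {f g : ℕ → ℤ} (hl : ∀ v ∈ l, v.natAbs ≤ M)
    (hf : ∀ k, (f k).natAbs ≤ M) (hg : ∀ k, (g k).natAbs ≤ M) (ω : ℕ → Bool) :
    Small M (tapeState l f g ω) := by
  refine ⟨natAbs_padded_le hl, fun a => ?_⟩
  simp only [tapeState_mem, splitMem]
  split_ifs
  exacts [hg _, hf _]

/-! ### Programs that write a list -/

/-- The state in which the output `o` has been written to the cells `0, 1, 2, …`, register 0 points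
to the next free cell, the other registers hold `l`, and the input `x` stands in the cells
`-1, -2, -3, …`. -/
def outState (l x o : List ℤ) (ω : ℕ → Bool) : State :=
  tapeState (o.length :: l) (padded x) (padded o) ω

/-- Appends the value of an expression to the output. -/
def emit (e : Expr) : Prog := .seq (.store (.reg 0) e) (.assign 0 (.add (.reg 0) (.const 1)))

/-- The number with a given index in the input. -/
def readInput (e : Expr) : Expr := .load (.sub (.const (-1)) e)

section

variable (l x o : List ℤ) (ω : ℕ → Bool)

@[simp]
theorem outState_reg_succ (r : ℕ) : (outState l x o ω).reg (r + 1) = l.getD r 0 := rfl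

variable {l} in
@[simp]
theorem outState_setReg_succ {r : ℕ} (hr : r < l.length) (v : ℤ) :
    (outState l x o ω).setReg (r + 1) v = outState (l.set r v) x o ω :=
  tapeState_setReg _ _ _ (by simpa using hr) v

theorem isBlock_emit (e : Expr) : (emit e).IsBlock := ⟨trivial, trivial⟩

theorem eval_emit (e : Expr) :
    (emit e).eval (outState l x o ω) = outState l x (o ++ [e.val (outState l x o ω)]) ω := by
  simp only [emit, Prog.eval]
  generalize e.val (outState l x o ω) = v
  simp [outState, Expr.val, padded_concat]

variable {l x o ω} in
theorem val_readInput {e : Expr} {k : ℕ} (he : e.val (outState l x o ω) = k) :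
    (readInput e).val (outState l x o ω) = padded x k := by
  simp only [readInput, Expr.val, he]
  exact splitMem_neg_one_sub _ _ k

end

/-- The lengths of the input `x` and of the output `F`, and the numbers in them, are at most `M`. -/
structure Fits (M : ℕ) (x F : List ℤ) : Prop where
  one_le : 1 ≤ M
  input : ∀ v ∈ x, v.natAbs ≤ M
  input_length : x.length ≤ M
  output : ∀ v ∈ F, v.natAbs ≤ M
  output_length : F.length ≤ M

/-- Within `N` steps, as counted by `Runs`, the program appends `w` to the output and changes the
registers from `l` to `l'`. What it appends has to agree with the intended output `F`, which is how
the numbers in the memory stay bounded. -/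
def Writes (M N : ℕ) (x F : List ℤ) (p : Prog) (l l' w : List ℤ) : Prop :=
  ∀ o ω, o ++ w <+: F → Runs M N p (outState l x o ω) (outState l' x (o ++ w) ω)

theorem flatMap_range_succ {α : Type*} (g : ℕ → List α) (k : ℕ) :
    (List.range (k + 1)).flatMap g = (List.range k).flatMap g ++ g k := by
  simp [List.range_succ]

theorem flatMap_range_isPrefix {α : Type*} (g : ℕ → List α) {i k : ℕ} (h : i ≤ k) :
    (List.range i).flatMap g <+: (List.range k).flatMap g := by
  obtain ⟨j, rfl⟩ := Nat.exists_eq_add_of_le h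
  rw [List.range_add, List.flatMap_append]
  exact List.prefix_append _ _

section

variable {M N N' : ℕ} {x F l l' l'' w w' : List ℤ} {p q : Prog}

theorem Fits.small (h : Fits M x F) {o : List ℤ} (ho : o <+: F) (hl : ∀ v ∈ l, v.natAbs ≤ M)
    (ω : ℕ → Bool) : Small M (outState l x o ω) := by
  have hlen : o.length ≤ M := ho.length_le.trans h.output_length
  exact Small.tapeState (by simpa [hlen] using hl) (natAbs_padded_le h.input)
    (natAbs_padded_le fun v hv => h.output v (ho.subset hv)) ω

theorem Writes.mono (h : Writes M N x F p l l' w) (hN : N ≤ N') : Writes M N' x F p l l' w :=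
  fun o ω ho => (h o ω ho).mono hN

theorem Writes.seq (hp : Writes M N x F p l l' w) (hq : Writes M N x F q l' l'' w') :
    Writes M N x F (.seq p q) l l'' (w ++ w') := by
  intro o ω ho
  rw [← List.append_assoc] at ho ⊢
  exact (hp o ω ((List.prefix_append _ _).trans ho)).seq (hq _ ω ho)

theorem Writes.block (h : Fits M x F) (hp : p.IsBlock) (hl : ∀ v ∈ l, v.natAbs ≤ M)
    (heval : ∀ o ω, p.eval (outState l x o ω) = outState l' x (o ++ w) ω) :
    Writes M 1 x F p l l' w := fun o ω ho =>
  .block hp h.one_le (h.small ((List.prefix_append _ _).trans ho) hl ω) (heval o ω)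

theorem Writes.loop (h : Fits M x F) (hN : 1 ≤ N) {e : Expr} (l g : ℕ → List ℤ) (k : ℕ)
    (hl : ∀ i ≤ k, ∀ v ∈ l i, v.natAbs ≤ M)
    (hpos : ∀ i < k, ∀ o ω, 0 < e.val (outState (l i) x o ω))
    (hend : ∀ o ω, e.val (outState (l k) x o ω) ≤ 0)
    (hbody : ∀ i < k, Writes M N x F p (l i) (l (i + 1)) (g i)) :
    Writes M ((k + 1) * N) x F (.loop e p) (l 0) (l k) ((List.range k).flatMap g) := by
  intro o ω ho
  have hpre : ∀ i ≤ k, o ++ (List.range i).flatMap g <+: F := fun i hi =>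
    ((List.prefix_append_right_inj o).2 (flatMap_range_isPrefix g hi)).trans ho
  have hloop := Runs.loop (e := e) (p := p) h.one_le hN
    (fun i => outState (l i) x (o ++ (List.range i).flatMap g) ω) k
    (fun i hi => hpos i hi _ ω) (hend _ ω) (fun i hi => h.small (hpre i hi) (hl i hi) ω)
    fun i hi => by
      have hnext := hpre (i + 1) hi
      rw [flatMap_range_succ, ← List.append_assoc] at hnext ⊢
      exact hbody i hi _ ω hnext
  simpa only [List.range_zero, List.flatMap_nil, List.append_nil] using hloop

end

/-! ### Transducers -/

/-- Moves the cell whose address is in register 4 to the negative part of the memory. -/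
def moveCell : Prog :=
  .seq (.store (.sub (.const (-1)) (.reg 4)) (.load (.reg 4)))
    (.seq (.store (.reg 4) (.const 0)) (.assign 4 (.add (.reg 4) (.const 1))))

/-- Moves the cells `0, …, L - 1` to the cells `-1, …, -L`, where `L` is in register 3; register 4
is the counter. -/
def moveInput : Prog :=
  .seq (.loop (.sub (.reg 3) (.reg 4)) moveCell) (.assign 4 (.const 0))

/-- Clears the cell `-1 - i`, where `i` is in register 4. -/
def clearCell : Prog :=
  .seq (.store (.sub (.const (-1)) (.reg 4)) (.const 0)) (.assign 4 (.add (.reg 4) (.const 1)))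

/-- Clears the cells `-1, …, -L`, where `L` is in register 3; register 4 is the counter. -/
def clearInput : Prog :=
  .seq (.assign 4 (.const 0)) (.loop (.sub (.reg 3) (.reg 4)) clearCell)

/-- Clears the registers `0, …, k - 1`. -/
def clearRegs : ℕ → Prog
  | 0 => .skip
  | k + 1 => .seq (clearRegs k) (.assign k (.const 0))

/-- Replaces the input by an output: `setup` puts the length of the input into register 3, and
`body` reads the input in the negative cells while writing the output to the other ones. Registers
from `k` on are not used. -/
def transduce (k : ℕ) (setup body : Prog) : Prog :=
  .seq setup (.seq moveInput (.seq body (.seq clearInput (clearRegs k))))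

theorem isBlock_clearRegs (k : ℕ) : (clearRegs k).IsBlock := by
  induction k with
  | zero => trivial
  | succ k ih => exact ⟨ih, trivial⟩

theorem eval_clearRegs (k : ℕ) (s : State) :
    (clearRegs k).eval s = { s with reg := fun r => if r < k then 0 else s.reg r } := by
  induction k with
  | zero => rfl
  | succ k ih =>
    simp only [clearRegs, Prog.eval, ih, State.setReg, Expr.val, State.mk.injEq, and_true]
    funext r
    simp only [Function.update_apply]
    grind

theorem eval_clearRegs_tapeState {k : ℕ} {l : List ℤ} (hl : l.length ≤ k) (f g : ℕ → ℤ)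
    (ω : ℕ → Bool) : (clearRegs k).eval (tapeState l f g ω) = tapeState [] f g ω := by
  simp only [eval_clearRegs, tapeState, State.mk.injEq, and_true]
  funext r
  split_ifs with hr
  · rfl
  · exact padded_eq_zero (by omega)

section

variable {M : ℕ} {x F l : List ℤ} {a b c z : ℤ}

theorem eval_moveCell (i : ℕ) (f g : ℕ → ℤ) (ω : ℕ → Bool) :
    moveCell.eval (tapeState (z :: a :: b :: c :: i :: l) f g ω) =
      tapeState (z :: a :: b :: c :: (i + 1 : ℕ) :: l) (Function.update f i (g i))
        (Function.update g i 0) ω := by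
  simp [moveCell, Prog.eval, Expr.val, splitMem_natCast]

theorem eval_clearCell (i : ℕ) (f g : ℕ → ℤ) (ω : ℕ → Bool) :
    clearCell.eval (tapeState (z :: a :: b :: c :: i :: l) f g ω) =
      tapeState (z :: a :: b :: c :: (i + 1 : ℕ) :: l) (Function.update f i 0) g ω := by
  simp [clearCell, Prog.eval, Expr.val]

theorem runs_moveInput (h : Fits M x F) (hl : ∀ v ∈ z :: a :: b :: l, v.natAbs ≤ M) (ω : ℕ → Bool) :
    Runs M (x.length + 1) moveInput (tapeState (z :: a :: b :: x.length :: 0 :: l) 0 (padded x) ω)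
      (tapeState (z :: a :: b :: x.length :: 0 :: l) (padded x) 0 ω) := by
  let st (i : ℕ) : State := tapeState (z :: a :: b :: x.length :: i :: l)
    (fun k => if k < i then padded x k else 0) (fun k => if k < i then 0 else padded x k) ω
  have hx := natAbs_padded_le h.input
  have hlen := h.input_length
  have hsmall : ∀ i ≤ x.length, Small M (st i) := fun i hi =>
    .tapeState (by
      simp only [List.forall_mem_cons] at hl ⊢
      exact ⟨hl.1, hl.2.1, hl.2.2.1, hlen, hi.trans hlen, hl.2.2.2⟩)
      (fun k => by split_ifs <;> simp [hx]) (fun k => by split_ifs <;> simp [hx]) ω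
  have hstep : ∀ i, moveCell.eval (st i) = st (i + 1) := fun i => by
    rw [eval_moveCell]
    congr 1 <;> funext k <;> simp only [Function.update_apply] <;> grind
  have hloop := Runs.loop (e := .sub (.reg 3) (.reg 4)) (p := moveCell) h.one_le le_rfl st x.length
    (fun i hi => by simpa [st, Expr.val] using hi) (by simp [st, Expr.val]) hsmall
    fun i hi => .block (by simp [moveCell, Prog.IsBlock]) h.one_le (hsmall i hi.le) (hstep i)
  have hend :
      st x.length = tapeState (z :: a :: b :: x.length :: x.length :: l) (padded x) 0 ω := by
    simp only [st]
    congr 1 <;> funext k <;> have := @padded_eq_zero x k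
    · grind
    · simp only [Pi.zero_apply]
      grind
  have hreset : Runs M 1 (.assign 4 (.const 0)) (st x.length)
      (tapeState (z :: a :: b :: x.length :: 0 :: l) (padded x) 0 ω) := by
    refine .block trivial h.one_le (hsmall _ le_rfl) ?_
    rw [hend]
    simp [Prog.eval, Expr.val]
  rw [mul_one] at hloop
  have hstart : st 0 = tapeState (z :: a :: b :: x.length :: 0 :: l) 0 (padded x) ω := by
    simp only [st, not_lt_zero, if_false]
    rfl
  exact hstart ▸ hloop.seq (hreset.mono (by omega))

theorem runs_clearInput (h : Fits M x F) (hl : ∀ v ∈ z :: a :: b :: c :: l, v.natAbs ≤ M)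
    (ω : ℕ → Bool) :
    Runs M (x.length + 1) clearInput
      (tapeState (z :: a :: b :: x.length :: c :: l) (padded x) (padded F) ω)
      (tapeState (z :: a :: b :: x.length :: x.length :: l) 0 (padded F) ω) := by
  let st (i : ℕ) : State := tapeState (z :: a :: b :: x.length :: i :: l)
    (fun k => if k < i then 0 else padded x k) (padded F) ω
  have hx := natAbs_padded_le h.input
  have hF := natAbs_padded_le h.output
  have hlen := h.input_length
  have hsmall : ∀ i ≤ x.length, Small M (st i) := fun i hi =>
    .tapeState (by
      simp only [List.forall_mem_cons] at hl ⊢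
      exact ⟨hl.1, hl.2.1, hl.2.2.1, hlen, hi.trans hlen, hl.2.2.2.2⟩)
      (fun k => by split_ifs <;> simp [hx]) hF ω
  have hstart : Runs M 1 (.assign 4 (.const 0))
      (tapeState (z :: a :: b :: x.length :: c :: l) (padded x) (padded F) ω) (st 0) := by
    refine .block trivial h.one_le (.tapeState ?_ hx hF ω) (by simp [st, Prog.eval, Expr.val])
    simp only [List.forall_mem_cons] at hl ⊢
    exact ⟨hl.1, hl.2.1, hl.2.2.1, hlen, hl.2.2.2⟩
  have hstep : ∀ i, clearCell.eval (st i) = st (i + 1) := fun i => by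
    rw [eval_clearCell]
    congr 1
    funext k
    simp only [Function.update_apply]
    grind
  have hloop := Runs.loop (e := .sub (.reg 3) (.reg 4)) (p := clearCell) h.one_le le_rfl st x.length
    (fun i hi => by simpa [st, Expr.val] using hi) (by simp [st, Expr.val]) hsmall
    fun i hi => .block (by simp [clearCell, Prog.IsBlock]) h.one_le (hsmall i hi.le) (hstep i)
  have hend : st x.length
      = tapeState (z :: a :: b :: x.length :: x.length :: l) 0 (padded F) ω := by
    simp only [st]
    congr 1
    funext k
    have := @padded_eq_zero x k
    simp only [Pi.zero_apply]
    grind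
  rw [mul_one] at hloop
  exact hend ▸ (hstart.mono (by omega)).seq hloop

end

theorem Runs.transduce {M N k : ℕ} {x F l l' : List ℤ} {a b a' b' c : ℤ} {setup body : Prog}
    {ω : ℕ → Bool} (h : Fits M x F) (hN : x.length + 1 ≤ N)
    (hl : ∀ v ∈ a :: b :: l, v.natAbs ≤ M) (hl' : ∀ v ∈ a' :: b' :: c :: l', v.natAbs ≤ M)
    (hk : l'.length + 5 ≤ k)
    (hsetup : Runs M N setup (initState x ω)
      (tapeState (0 :: a :: b :: x.length :: 0 :: l) 0 (padded x) ω))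
    (hbody : Writes M N x F body (a :: b :: x.length :: 0 :: l)
      (a' :: b' :: x.length :: c :: l') F) :
    Runs M N (transduce k setup body) (initState x ω) (initState F ω) := by
  have hmove := runs_moveInput (z := 0) h (List.forall_mem_cons.2 ⟨by simp, hl⟩) ω
  have hwrite : Runs M N body _ _ := hbody [] ω List.prefix_rfl
  have hlen := h.output_length
  have hclear := runs_clearInput (z := F.length) h (List.forall_mem_cons.2 ⟨hlen, hl'⟩) ω
  have hregs : Runs M 1 (clearRegs k)
      (tapeState (F.length :: a' :: b' :: x.length :: x.length :: l') 0 (padded F) ω)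
      (initState F ω) := by
    have hlength : (a' :: b' :: (x.length : ℤ) :: (x.length : ℤ) :: l').length < k := by
      simp only [List.length_cons]
      omega
    refine .block (isBlock_clearRegs k) h.one_le (.tapeState ?_ (by simp)
      (natAbs_padded_le h.output) ω) (eval_clearRegs_tapeState hlength _ _ ω)
    simp only [List.forall_mem_cons] at hl' ⊢
    exact ⟨hlen, hl'.1, hl'.2.1, h.input_length, h.input_length, hl'.2.2.2⟩
  exact hsetup.seq ((hmove.mono hN).seq (hwrite.seq ((hclear.mono hN).seq
    (hregs.mono (by omega)))))

/-! ### Orthogonal Vectors as sparse regression -/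

/-- Coordinate `l` of the vector with index `c`, where the vectors of `U` come before those of
`V`; it is `false` out of range. -/
def OVInstance.bit (I : OVInstance) (c l : ℕ) : Bool :=
  if hl : l < I.d then
    if hc : c < I.n then I.U ⟨c, hc⟩ ⟨l, hl⟩
    else if hc' : c - I.n < I.n then I.V ⟨c - I.n, hc'⟩ ⟨l, hl⟩ else false
  else false

/-- The design matrix, with column index `c` and row index `l`: the scaled vectors, and two rows
that force a solution to use one vector of `U` and one vector of `V`, with coefficients close
to `1`. -/
def OVInstance.slrEntry (I : OVInstance) (c l : ℕ) : ℤ :=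
  if l < I.d then 4 * (I.bit c l).toNat
  else if l = I.d then if c < I.n then 24 * I.d else 0
  else if l = I.d + 1 then if c < I.n then 0 else 24 * I.d
  else 0

/-- The target vector; its last coordinate makes the error bound an integer. -/
def OVInstance.slrTarget (I : OVInstance) (l : ℕ) : ℤ :=
  if l < I.d then 2 else if l < I.d + 2 then 24 * I.d else I.d - 1

/-- The instance of sparse regression for an instance of Orthogonal Vectors. -/
def OVInstance.toSLR (I : OVInstance) : SLRInstance where
  d := I.d + 3
  n := I.n + I.n
  d_pos := by omega
  n_pos := Nat.add_pos_left I.n_pos _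
  A := fun i j => (I.slrEntry j i : ℚ)
  b := fun i => (I.slrTarget i : ℚ)
  δ := I.d + 1
  δ_pos := by positivity

/-- The squared error of the coefficients `y` of the vectors of `U` and `z` of the vectors of
`V`. -/
def OVInstance.sqError (I : OVInstance) (y z : Fin I.n → ℝ) : ℝ :=
  ∑ l, (∑ i, 4 * ((I.U i l).toNat : ℝ) * y i + ∑ j, 4 * ((I.V j l).toNat : ℝ) * z j - 2) ^ 2 +
    (24 * I.d * ∑ i, y i - 24 * I.d) ^ 2 + (24 * I.d * ∑ j, z j - 24 * I.d) ^ 2 +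
    ((I.d : ℝ) - 1) ^ 2

theorem setOf_append_single_ne_zero_ncard_le {R : Type*} [Zero R] {m n : ℕ} (i : Fin m) (j : Fin n)
    (s t : R) :
    {c | Fin.append (Pi.single i s : Fin m → R) (Pi.single j t) c ≠ 0}.ncard ≤ 2 := by
  have hpair : ({Fin.castAdd n i, Fin.natAdd m j} : Set (Fin (m + n))).ncard ≤ 2 :=
    (Set.ncard_insert_le _ _).trans (by rw [Set.ncard_singleton])
  refine (Set.ncard_le_ncard ?_ (Set.toFinite _)).trans hpair
  intro c
  induction c using Fin.addCases with
  | left c => simpa [Pi.single_apply] using fun h _ => Or.inl h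
  | right c => simpa [Pi.single_apply] using fun h _ => Or.inr h

theorem exists_eq_single_of_append_ncard_le {R : Type*} [Zero R] {m n : ℕ} {y : Fin m → R}
    {z : Fin n → R} (h : {c | Fin.append y z c ≠ 0}.ncard ≤ 2) (hy : y ≠ 0) (hz : z ≠ 0) :
    ∃ i j s t, y = Pi.single i s ∧ z = Pi.single j t := by
  obtain ⟨i, hi⟩ := Function.ne_iff.1 hy
  obtain ⟨j, hj⟩ := Function.ne_iff.1 hz
  have hne : ∀ (i' : Fin m) (j' : Fin n), Fin.castAdd n i' ≠ Fin.natAdd m j' := fun i' j' hij => by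
    have := congrArg Fin.val hij
    simp only [Fin.val_castAdd, Fin.val_natAdd] at this
    omega
  have hsupp : {Fin.castAdd n i, Fin.natAdd m j} = {c | Fin.append y z c ≠ 0} := by
    refine Set.eq_of_subset_of_ncard_le ?_ (by rwa [Set.ncard_pair (hne i j)]) (Set.toFinite _)
    rintro c (rfl | rfl)
    exacts [by simpa using hi, by simpa using hj]
  refine ⟨i, j, y i, z j, funext fun i' => ?_, funext fun j' => ?_⟩
  · have := Set.ext_iff.1 hsupp (Fin.castAdd n i')
    simp only [Set.mem_insert_iff, Set.mem_singleton_iff, hne, Fin.castAdd_inj] at this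
    by_cases hii : i' = i <;> simp_all
  · have := Set.ext_iff.1 hsupp (Fin.natAdd m j')
    simp only [Set.mem_insert_iff, Set.mem_singleton_iff, (hne _ _).symm, Fin.natAdd_inj] at this
    by_cases hjj : j' = j <;> simp_all

section

variable (I : OVInstance)

theorem OVInstance.slrEntry_castAdd (i : Fin I.n) (l : Fin I.d) :
    I.slrEntry (Fin.castAdd I.n i) l = 4 * (I.U i l).toNat := by
  simp [OVInstance.slrEntry, OVInstance.bit]

theorem OVInstance.slrEntry_natAdd (j : Fin I.n) (l : Fin I.d) :
    I.slrEntry (Fin.natAdd I.n j) l = 4 * (I.V j l).toNat := by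
  simp [OVInstance.slrEntry, OVInstance.bit]

theorem OVInstance.toSLR_residual_apply (x : Fin (I.n + I.n) → ℝ) (r : Fin (I.d + 3)) :
    ((I.toSLR.A.map fun q : ℚ => (q : ℝ)).mulVec x - fun i => (I.toSLR.b i : ℝ)) r =
      ∑ c : Fin (I.n + I.n), (I.slrEntry c r : ℝ) * x c - I.slrTarget r := by
  change ∑ c : Fin (I.n + I.n), ((I.slrEntry c r : ℚ) : ℝ) * x c - ((I.slrTarget r : ℚ) : ℝ) = _
  simp only [Rat.cast_intCast]

theorem OVInstance.toSLR_norm_sq (y z : Fin I.n → ℝ) :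
    ‖(WithLp.toLp 2 ((I.toSLR.A.map fun q : ℚ => (q : ℝ)).mulVec (Fin.append y z) -
      fun i => (I.toSLR.b i : ℝ)) : EuclideanSpace ℝ (Fin I.toSLR.d))‖ ^ 2 = I.sqError y z := by
  rw [EuclideanSpace.real_norm_sq_eq]
  refine (Finset.sum_congr rfl fun r _ => congrArg (· ^ 2) (I.toSLR_residual_apply _ r)).trans ?_
  change ∑ r : Fin (I.d + 3), _ = _
  simp only [Fin.sum_univ_castSucc (n := _ + 1), Fin.sum_univ_castSucc (n := I.d),
    Fin.sum_univ_add, Fin.append_left, Fin.append_right, Fin.val_castSucc, I.slrEntry_castAdd,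
    I.slrEntry_natAdd]
  have hlt : ¬ I.d + 1 + 1 < I.d := by omega
  have hne : I.d + 1 + 1 ≠ I.d := by omega
  simp [OVInstance.sqError, OVInstance.slrEntry, OVInstance.slrTarget, Finset.mul_sum, hlt, hne,
    sub_sq_comm (1 : ℝ) I.d]

theorem OVInstance.toSLR_isYes_iff_exists_sqError_le : I.toSLR.IsYes 2 ↔
    ∃ y z : Fin I.n → ℝ, {c | Fin.append y z c ≠ 0}.ncard ≤ 2 ∧
      I.sqError y z ≤ ((I.d : ℝ) + 1) ^ 2 := by
  have hδ : (I.toSLR.δ : ℝ) = I.d + 1 := by simp [OVInstance.toSLR]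
  have hle : ∀ y z : Fin I.n → ℝ, _ ↔ I.sqError y z ≤ ((I.d : ℝ) + 1) ^ 2 := fun y z => by
    rw [← I.toSLR_norm_sq, sq_le_sq₀ (norm_nonneg _) (by positivity), ← hδ]
  constructor
  · rintro ⟨x, hx, hδx⟩
    obtain ⟨y, z, rfl⟩ : ∃ y z : Fin I.n → ℝ, x = Fin.append y z :=
      ⟨_, _, (Fin.append_castAdd_natAdd (f := x)).symm⟩
    exact ⟨y, z, hx, (hle y z).1 hδx⟩
  · rintro ⟨y, z, hyz, herr⟩
    exact ⟨Fin.append y z, hyz, (hle y z).2 herr⟩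

theorem OVInstance.sqError_single (i j : Fin I.n) (s t : ℝ) :
    I.sqError (Pi.single i s) (Pi.single j t) =
      ∑ l, (4 * ((I.U i l).toNat : ℝ) * s + 4 * ((I.V j l).toNat : ℝ) * t - 2) ^ 2 +
        (24 * I.d * s - 24 * I.d) ^ 2 + (24 * I.d * t - 24 * I.d) ^ 2 + ((I.d : ℝ) - 1) ^ 2 := by
  simp [OVInstance.sqError, Pi.single_apply]

variable {I}

theorem OVInstance.ne_zero_of_sqError_le {y z : Fin I.n → ℝ}
    (h : I.sqError y z ≤ ((I.d : ℝ) + 1) ^ 2) : y ≠ 0 ∧ z ≠ 0 := by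
  have hd : (1 : ℝ) ≤ I.d := by exact_mod_cast I.d_pos
  have hsum : 0 ≤ ∑ l, (∑ i, 4 * ((I.U i l).toNat : ℝ) * y i +
      ∑ j, 4 * ((I.V j l).toNat : ℝ) * z j - 2) ^ 2 := Finset.sum_nonneg fun _ _ => sq_nonneg _
  have hy := sq_nonneg (24 * I.d * ∑ i, y i - 24 * (I.d : ℝ))
  have hz := sq_nonneg (24 * I.d * ∑ j, z j - 24 * (I.d : ℝ))
  unfold OVInstance.sqError at h
  constructor <;> rintro rfl
  · have hzero : ∑ i : Fin I.n, (0 : Fin I.n → ℝ) i = 0 := by simp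
    rw [hzero] at h
    nlinarith
  · have hzero : ∑ i : Fin I.n, (0 : Fin I.n → ℝ) i = 0 := by simp
    rw [hzero] at h
    nlinarith

theorem sq_coord_lower_bound (u v : Bool) (s t : ℝ) :
    4 + 32 * ((u.toNat * v.toNat : ℕ) : ℝ) - 48 * (|s| + |t|) ≤
      (4 * u.toNat * (1 + s) + 4 * v.toNat * (1 + t) - 2) ^ 2 := by
  have hs := neg_abs_le s
  have hs' := le_abs_self s
  have ht := neg_abs_le t
  have ht' := le_abs_self t
  cases u <;> cases v <;>
    simp only [Bool.toNat_false, Bool.toNat_true, Nat.cast_zero, Nat.cast_one, mul_zero, mul_one]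
  · nlinarith [abs_nonneg s, abs_nonneg t]
  · nlinarith [sq_nonneg t, abs_nonneg s]
  · nlinarith [sq_nonneg s, abs_nonneg t]
  · nlinarith [sq_nonneg (s + t)]

theorem OVInstance.inner_eq_zero_of_sqError_single_le {i j : Fin I.n} {s t : ℝ}
    (h : I.sqError (Pi.single i s) (Pi.single j t) ≤ ((I.d : ℝ) + 1) ^ 2) :
    ∑ l, (I.U i l).toNat * (I.V j l).toNat = 0 := by
  obtain ⟨s, rfl⟩ : ∃ s', s = 1 + s' := ⟨_, (add_sub_cancel _ _).symm⟩
  obtain ⟨t, rfl⟩ : ∃ t', t = 1 + t' := ⟨_, (add_sub_cancel _ _).symm⟩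
  rw [OVInstance.sqError_single] at h
  have hsum : ∑ l, (4 + 32 * (((I.U i l).toNat * (I.V j l).toNat : ℕ) : ℝ)
      - 48 * (|s| + |t|)) ≤ _ :=
    Finset.sum_le_sum fun l _ => sq_coord_lower_bound (I.U i l) (I.V j l) s t
  simp only [Finset.sum_sub_distrib, Finset.sum_add_distrib, ← Finset.mul_sum, ← Nat.cast_sum,
    Finset.sum_const, Finset.card_univ, Fintype.card_fin, nsmul_eq_mul] at hsum
  by_contra hpos
  have hpos' : (1 : ℝ) ≤ ((∑ l, (I.U i l).toNat * (I.V j l).toNat : ℕ) : ℝ) := by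
    exact_mod_cast Nat.one_le_iff_ne_zero.2 hpos
  have hrow : ∀ r : ℝ, 48 * (I.d * |r|) - (24 * I.d * (1 + r) - 24 * I.d) ^ 2 ≤ 1 := fun r => by
    nlinarith [sq_nonneg (24 * I.d * |r| - 1), sq_abs r]
  linarith [hrow s, hrow t]

theorem OVInstance.sqError_single_le_of_inner_eq_zero {i j : Fin I.n}
    (h : ∑ l, (I.U i l).toNat * (I.V j l).toNat = 0) :
    I.sqError (Pi.single i 1) (Pi.single j 1) ≤ ((I.d : ℝ) + 1) ^ 2 := by
  have hcoord : ∀ l,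
      (4 * ((I.U i l).toNat : ℝ) * 1 + 4 * ((I.V j l).toNat : ℝ) * 1 - 2) ^ 2 = 4 := fun l => by
    have hl := Finset.sum_eq_zero_iff.1 h l (Finset.mem_univ l)
    revert hl
    cases I.U i l <;> cases I.V j l <;> norm_num
  simp only [OVInstance.sqError_single, hcoord, Finset.sum_const, Finset.card_univ,
    Fintype.card_fin, nsmul_eq_mul]
  linarith

variable (I) in
theorem OVInstance.toSLR_isYes_iff : I.toSLR.IsYes 2 ↔ I.IsYes := by
  rw [OVInstance.toSLR_isYes_iff_exists_sqError_le]
  constructor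
  · rintro ⟨y, z, hyz, h⟩
    obtain ⟨hy, hz⟩ := OVInstance.ne_zero_of_sqError_le h
    obtain ⟨i, j, s, t, rfl, rfl⟩ := exists_eq_single_of_append_ncard_le hyz hy hz
    exact ⟨i, j, OVInstance.inner_eq_zero_of_sqError_single_le h⟩
  · rintro ⟨i, j, h⟩
    exact ⟨_, _, setOf_append_single_ne_zero_ncard_le i j 1 1,
      OVInstance.sqError_single_le_of_inner_eq_zero h⟩

end

/-! ### Encodings of vectors and regression instances -/

theorem length_flatMap_range {α : Type*} {g : ℕ → List α} {w : ℕ} (hg : ∀ c, (g c).length = w)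
    (k : ℕ) : ((List.range k).flatMap g).length = k * w := by
  simp [List.length_flatMap, hg]

theorem padded_append_length_add (x y : List ℤ) (k : ℕ) :
    padded (x ++ y) (x.length + k) = padded y k := by
  rw [padded, List.getD_append_right _ _ _ _ (by omega), Nat.add_sub_cancel_left, padded]

theorem padded_flatMap_range {g : ℕ → List ℤ} {w : ℕ} (hg : ∀ c, (g c).length = w) {k c l : ℕ}
    (hc : c < k) (hl : l < w) : padded ((List.range k).flatMap g) (c * w + l) = padded (g c) l := by
  obtain ⟨z, hz⟩ := flatMap_range_isPrefix g (Nat.succ_le_of_lt hc)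
  rw [← hz, flatMap_range_succ, List.append_assoc, ← length_flatMap_range hg c,
    padded_append_length_add, padded, List.getD_append _ _ _ _ (by rwa [hg]), padded]

theorem ofFn_eq_map_range {α : Type*} {n : ℕ} (g : ℕ → α) :
    (List.ofFn fun i : Fin n => g i) = (List.range n).map g := by
  apply List.ext_getElem <;> simp

theorem flatten_ofFn_eq_flatMap_range {α : Type*} {n : ℕ} (g : ℕ → List α) :
    (List.ofFn fun i : Fin n => g i).flatten = (List.range n).flatMap g := by
  rw [ofFn_eq_map_range, List.flatMap_def]

theorem flatMap_range_congr {α : Type*} {g g' : ℕ → List α} {k : ℕ} (h : ∀ i < k, g i = g' i) :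
    (List.range k).flatMap g = (List.range k).flatMap g' := by
  simp only [List.flatMap_def]
  congr 1
  exact List.map_congr_left fun i hi => h i (List.mem_range.1 hi)

theorem encodeBits_eq_map_range {d : ℕ} {u : Fin d → Bool} {f : ℕ → Bool} (h : ∀ l, u l = f l) :
    encodeBits u = (List.range d).map fun l => ((f l).toNat : ℤ) := by
  rw [← ofFn_eq_map_range, encodeBits]
  congr 1
  funext l
  rw [h]
  cases f l <;> rfl

theorem encodeRat_intCast (z : ℤ) : encodeRat z = [z, 1] := by simp [encodeRat]

section

variable (I : OVInstance)

theorem OVInstance.encode_eq : I.encode =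
    [(I.n : ℤ), (I.d : ℤ)] ++ (List.range (I.n + I.n)).flatMap fun c =>
      (List.range I.d).map fun l => ((I.bit c l).toNat : ℤ) := by
  have hU (i : Fin I.n) : encodeBits (I.U i)
      = (List.range I.d).map fun l => ((I.bit i l).toNat : ℤ) :=
    encodeBits_eq_map_range fun l => by simp [OVInstance.bit]
  have hV (j : Fin I.n) : encodeBits (I.V j)
      = (List.range I.d).map fun l => ((I.bit (I.n + j) l).toNat : ℤ) :=
    encodeBits_eq_map_range fun l => by simp [OVInstance.bit]
  simp only [OVInstance.encode, hU, hV]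
  rw [flatten_ofFn_eq_flatMap_range fun i => (List.range I.d).map fun l => ((I.bit i l).toNat : ℤ),
    flatten_ofFn_eq_flatMap_range fun j =>
      (List.range I.d).map fun l => ((I.bit (I.n + j) l).toNat : ℤ),
    List.range_add, List.flatMap_append, List.flatMap_map, List.append_assoc]

theorem OVInstance.length_encode : I.encode.length = 2 + (I.n + I.n) * I.d := by
  rw [I.encode_eq, List.length_append, length_flatMap_range (w := I.d) (by simp)]
  rfl

theorem OVInstance.padded_encode {c l : ℕ} (hc : c < I.n + I.n) (hl : l < I.d) :
    padded I.encode (2 + (c * I.d + l)) = (I.bit c l).toNat := by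
  rw [I.encode_eq]
  refine (padded_append_length_add _ _ _).trans ?_
  rw [padded_flatMap_range (w := I.d) (by simp) hc hl]
  simp [padded, hl]

/-- The beginning of the encoding of the regression instance: dimensions and error bound. -/
def OVInstance.slrHead : List ℤ := [I.d + 3, I.n + I.n, I.d + 1, 1]

/-- The encoding of the target vector. -/
def OVInstance.slrTargetCode : List ℤ :=
  (List.range I.d).flatMap (fun _ => [(2 : ℤ), 1]) ++ [24 * (I.d : ℤ), 1, 24 * I.d, 1, I.d - 1, 1]

/-- The encoding of the last three entries of a column of the design matrix. -/
def OVInstance.slrColumnEnd (c : ℕ) : List ℤ :=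
  if c < I.n then [24 * (I.d : ℤ), 1, 0, 1, 0, 1] else [0, 1, 24 * (I.d : ℤ), 1, 0, 1]

/-- The encoding of a column of the design matrix. -/
def OVInstance.slrColumnCode (c : ℕ) : List ℤ :=
  (List.range I.d).flatMap (fun l => [4 * ((I.bit c l).toNat : ℤ), 1]) ++ I.slrColumnEnd c

theorem OVInstance.flatten_encodeRat_slrTarget :
    (List.ofFn fun i => encodeRat (I.toSLR.b i)).flatten = I.slrTargetCode := by
  refine (flatten_ofFn_eq_flatMap_range (n := I.d + 3) fun i => encodeRat (I.slrTarget i)).trans ?_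
  simp only [encodeRat_intCast, List.range_add, List.flatMap_append, OVInstance.slrTargetCode]
  congr 1
  · exact flatMap_range_congr fun l hl => by rw [OVInstance.slrTarget, if_pos hl]
  · simp [List.range_succ, OVInstance.slrTarget]

theorem OVInstance.flatten_encodeRat_slrEntry (c : ℕ) :
    (List.ofFn fun i : Fin (I.d + 3) => encodeRat (I.slrEntry c i)).flatten =
      I.slrColumnCode c := by
  rw [flatten_ofFn_eq_flatMap_range fun i => encodeRat (I.slrEntry c i)]
  simp only [encodeRat_intCast, List.range_add, List.flatMap_append, OVInstance.slrColumnCode,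
    OVInstance.slrColumnEnd]
  congr 1
  · exact flatMap_range_congr fun l hl => by rw [OVInstance.slrEntry, if_pos hl]
  · split_ifs with hc <;> simp [List.range_succ, OVInstance.slrEntry, hc]

theorem OVInstance.encode_toSLR : I.toSLR.encode =
    I.slrHead ++ (I.slrTargetCode ++ (List.range (I.n + I.n)).flatMap I.slrColumnCode) := by
  have hδ : encodeRat I.toSLR.δ = [(I.d : ℤ) + 1, 1] := by
    rw [← encodeRat_intCast]
    push_cast
    rfl
  have hcolumns :
      (List.ofFn fun j => (List.ofFn fun i => encodeRat (I.toSLR.A i j)).flatten).flatten =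
        (List.range (I.n + I.n)).flatMap I.slrColumnCode := by
    rw [← flatten_ofFn_eq_flatMap_range]
    exact congrArg (List.flatten ∘ List.ofFn) (funext fun j => I.flatten_encodeRat_slrEntry j)
  rw [SLRInstance.encode, hδ, hcolumns, I.flatten_encodeRat_slrTarget]
  simp [OVInstance.slrHead, OVInstance.toSLR]

/-! ### The size of the regression instance -/

/-- A bound for all numbers that occur while the regression instance is computed. -/
def OVInstance.bound : ℕ := 100 * (I.n * I.d)

theorem OVInstance.n_le_mul : I.n ≤ I.n * I.d := Nat.le_mul_of_pos_right _ I.d_pos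

theorem OVInstance.d_le_mul : I.d ≤ I.n * I.d := Nat.le_mul_of_pos_left _ I.n_pos

theorem OVInstance.bit_natAbs_le (c l : ℕ) : ((I.bit c l).toNat : ℤ).natAbs ≤ 1 :=
  Bool.toNat_le _

theorem OVInstance.natAbs_le_of_mem_encode {v : ℤ} (hv : v ∈ I.encode) : v.natAbs ≤ I.bound := by
  have hn := I.n_le_mul
  have hd := I.d_le_mul
  have hpos := I.d_pos
  rw [I.encode_eq] at hv
  simp only [List.mem_append, List.mem_flatMap, List.mem_map, List.mem_cons, List.not_mem_nil,
    or_false] at hv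
  rw [OVInstance.bound]
  rcases hv with (rfl | rfl) | ⟨c, -, l, -, rfl⟩
  · omega
  · omega
  · have := I.bit_natAbs_le c l
    omega

theorem OVInstance.natAbs_le_of_mem_slrColumnCode {c : ℕ} {v : ℤ} (hv : v ∈ I.slrColumnCode c) :
    v.natAbs ≤ 24 * I.d := by
  have hpos := I.d_pos
  simp only [OVInstance.slrColumnCode, OVInstance.slrColumnEnd, List.mem_append, List.mem_flatMap,
    List.mem_cons, List.not_mem_nil, or_false] at hv
  rcases hv with ⟨l, -, hv⟩ | hv
  · have := I.bit_natAbs_le c l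
    omega
  · split_ifs at hv <;> simp only [List.mem_cons, List.not_mem_nil, or_false] at hv <;> omega

theorem OVInstance.natAbs_le_of_mem_encode_toSLR {v : ℤ} (hv : v ∈ I.toSLR.encode) :
    v.natAbs ≤ I.bound := by
  have hn := I.n_le_mul
  have hd := I.d_le_mul
  have hpos := I.d_pos
  rw [I.encode_toSLR] at hv
  simp only [List.mem_append, List.mem_flatMap, OVInstance.slrHead, OVInstance.slrTargetCode,
    List.mem_cons, List.not_mem_nil, or_false] at hv
  rw [OVInstance.bound]
  rcases hv with hv | (⟨-, -, hv⟩ | hv) | ⟨c, -, hv⟩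
  · omega
  · omega
  · omega
  · have := I.natAbs_le_of_mem_slrColumnCode hv
    omega

theorem OVInstance.length_slrColumnCode (c : ℕ) : (I.slrColumnCode c).length = I.d * 2 + 6 := by
  rw [OVInstance.slrColumnCode, List.length_append, length_flatMap_range (w := 2) (by simp),
    OVInstance.slrColumnEnd]
  split_ifs <;> rfl

theorem OVInstance.length_encode_toSLR_le : I.toSLR.encode.length ≤ I.bound := by
  have hn := I.n_le_mul
  have hd := I.d_le_mul
  have hpos := I.d_pos
  have hmul : (I.n + I.n) * (I.d * 2 + 6) = 4 * (I.n * I.d) + 12 * I.n := by ring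
  simp only [I.encode_toSLR, OVInstance.slrHead, OVInstance.slrTargetCode, List.length_append,
    length_flatMap_range I.length_slrColumnCode,
    length_flatMap_range (w := 2) (g := fun _ => [(2 : ℤ), 1]) (by simp), List.length_cons,
    List.length_nil, OVInstance.bound]
  omega

theorem OVInstance.length_encode_le : I.encode.length ≤ 4 * (I.n * I.d) := by
  have hn := I.n_le_mul
  have hpos := I.n_pos
  have hmul : (I.n + I.n) * I.d = 2 * (I.n * I.d) := by ring
  rw [I.length_encode]
  omega

theorem OVInstance.fits : Fits I.bound I.encode I.toSLR.encode where
  one_le := Nat.mul_pos (by norm_num) (Nat.mul_pos I.n_pos I.d_pos)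
  input _ := I.natAbs_le_of_mem_encode
  input_length := I.length_encode_le.trans (Nat.mul_le_mul_right _ (by norm_num))
  output _ := I.natAbs_le_of_mem_encode_toSLR
  output_length := I.length_encode_toSLR_le

theorem OVInstance.bits_toSLR_le : I.toSLR.bits ≤ 24 * I.d := by
  have hd := I.d_pos
  refine max_le ?_ (max_le (Finset.sup_le fun i _ => ?_)
    (Finset.sup_le fun i _ => Finset.sup_le fun j _ => ?_))
  · have hδ : I.toSLR.δ = ((I.d + 1 : ℤ) : ℚ) := by push_cast; rfl
    rw [hδ]
    exact ratBits_intCast_le (by omega) (by omega)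
  · refine ratBits_intCast_le (by omega) ?_
    rw [OVInstance.slrTarget]
    split_ifs <;> omega
  · refine ratBits_intCast_le (by omega) ?_
    have := I.bit_natAbs_le j i
    rw [OVInstance.slrEntry]
    split_ifs <;> omega

end

/-! ### A program for the reduction to sparse regression

Register 1 holds the number of vectors, register 2 the dimension, register 3 the length of the
input, register 4 counts columns and register 5 counts rows. -/

/-- Reads the dimensions and computes the length of the input. -/
def ovSetup : Prog :=
  .seq (.assign 1 (.load (.const 0))) (.seq (.assign 2 (.load (.const 1)))
    (.assign 3 (.add (.const 2) (.mul (.add (.reg 1) (.reg 1)) (.reg 2)))))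

/-- Writes the dimensions and the error bound. -/
def writeSLRHead : Prog :=
  .seq (emit (.add (.reg 2) (.const 3))) (.seq (emit (.add (.reg 1) (.reg 1)))
    (.seq (emit (.add (.reg 2) (.const 1))) (emit (.const 1))))

/-- Writes one of the first coordinates of the target vector. -/
def writeSLRTwo : Prog :=
  .seq (emit (.const 2)) (.seq (emit (.const 1)) (.assign 5 (.add (.reg 5) (.const 1))))

/-- Writes the last three coordinates of the target vector. -/
def writeSLRTargetEnd : Prog :=
  .seq (emit (.mul (.const 24) (.reg 2))) (.seq (emit (.const 1))
    (.seq (emit (.mul (.const 24) (.reg 2))) (.seq (emit (.const 1))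
      (.seq (emit (.sub (.reg 2) (.const 1))) (.seq (emit (.const 1)) (.assign 5 (.const 0)))))))

/-- Writes the target vector. -/
def writeSLRTarget : Prog :=
  .seq (.loop (.sub (.reg 2) (.reg 5)) writeSLRTwo) writeSLRTargetEnd

/-- Writes one of the first entries of a column of the design matrix. -/
def writeSLREntry : Prog :=
  .seq (emit (.mul (.const 4)
      (readInput (.add (.const 2) (.add (.mul (.reg 4) (.reg 2)) (.reg 5))))))
    (.seq (emit (.const 1)) (.assign 5 (.add (.reg 5) (.const 1))))

/-- Writes the last three entries of a column of the design matrix. -/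
def writeSLRColumnEnd : Prog :=
  .seq (.ite (.sub (.reg 1) (.reg 4))
      (.seq (emit (.mul (.const 24) (.reg 2))) (.seq (emit (.const 1))
        (.seq (emit (.const 0)) (emit (.const 1)))))
      (.seq (emit (.const 0)) (.seq (emit (.const 1))
        (.seq (emit (.mul (.const 24) (.reg 2))) (emit (.const 1))))))
    (.seq (emit (.const 0)) (.seq (emit (.const 1))
      (.seq (.assign 5 (.const 0)) (.assign 4 (.add (.reg 4) (.const 1))))))

/-- Writes a column of the design matrix. -/
def writeSLRColumn : Prog :=
  .seq (.loop (.sub (.reg 2) (.reg 5)) writeSLREntry) writeSLRColumnEnd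

/-- Writes the regression instance. -/
def writeSLR : Prog :=
  .seq writeSLRHead (.seq writeSLRTarget
    (.loop (.sub (.add (.reg 1) (.reg 1)) (.reg 4)) writeSLRColumn))

theorem isBlock_writeSLRHead : writeSLRHead.IsBlock := by
  simp [writeSLRHead, Prog.IsBlock, isBlock_emit]

theorem isBlock_writeSLRTwo : writeSLRTwo.IsBlock := by
  simp [writeSLRTwo, Prog.IsBlock, isBlock_emit]

theorem isBlock_writeSLRTargetEnd : writeSLRTargetEnd.IsBlock := by
  simp [writeSLRTargetEnd, Prog.IsBlock, isBlock_emit]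

theorem isBlock_writeSLREntry : writeSLREntry.IsBlock := by
  simp [writeSLREntry, Prog.IsBlock, isBlock_emit]

theorem isBlock_writeSLRColumnEnd : writeSLRColumnEnd.IsBlock := by
  simp [writeSLRColumnEnd, Prog.IsBlock, isBlock_emit]

theorem tapeState_replicate_zero (k : ℕ) (f g : ℕ → ℤ) (ω : ℕ → Bool) :
    tapeState (List.replicate k 0) f g ω = tapeState [] f g ω := by
  simp only [tapeState, State.mk.injEq, and_true]
  funext r
  simp only [padded, List.getD_eq_getElem?_getD, List.getElem?_replicate]
  split_ifs <;> rfl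

namespace OVInstance

variable (I : OVInstance)

/-- The registers from 1 on, where `c` columns and `l` rows of the current column are done. -/
def regs (c l : ℕ) : List ℤ := [I.n, I.d, I.encode.length, c, l]

theorem natAbs_le_of_mem_regs {c l : ℕ} (hc : c ≤ I.n + I.n) (hl : l ≤ I.d) :
    ∀ v ∈ I.regs c l, v.natAbs ≤ I.bound := by
  have hn := I.n_le_mul
  have hd := I.d_le_mul
  have hlen := I.length_encode_le
  simp only [regs, bound, List.forall_mem_cons, Int.natAbs_natCast, List.not_mem_nil,
    IsEmpty.forall_iff, implies_true, and_true]
  omega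

theorem runs_ovSetup (ω : ℕ → Bool) : Runs I.bound 1 ovSetup (initState I.encode ω)
    (tapeState [0, I.n, I.d, I.encode.length, 0, 0] 0 (padded I.encode) ω) := by
  have h := I.fits
  rw [initState_eq_tapeState, ← tapeState_replicate_zero 6]
  refine .block ⟨trivial, trivial, trivial⟩ h.one_le
    (.tapeState (by simp) (by simp) (natAbs_padded_le h.input) ω) ?_
  have hn : splitMem 0 (padded I.encode) 0 = I.n := by
    rw [I.encode_eq]; exact splitMem_natCast _ _ 0
  have hd : splitMem 0 (padded I.encode) 1 = I.d := by
    rw [I.encode_eq]; exact splitMem_natCast _ _ 1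
  simp [ovSetup, Prog.eval, Expr.val, hn, hd, I.length_encode]

theorem eval_writeSLRHead (o : List ℤ) (ω : ℕ → Bool) :
    writeSLRHead.eval (outState (I.regs 0 0) I.encode o ω)
      = outState (I.regs 0 0) I.encode (o ++ I.slrHead) ω := by
  simp [writeSLRHead, Prog.eval, eval_emit, Expr.val, slrHead, regs]

theorem eval_writeSLRTwo (l : ℕ) (o : List ℤ) (ω : ℕ → Bool) :
    writeSLRTwo.eval (outState (I.regs 0 l) I.encode o ω)
      = outState (I.regs 0 (l + 1)) I.encode (o ++ [2, 1]) ω := by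
  simp [writeSLRTwo, Prog.eval, eval_emit, Expr.val, regs]

theorem eval_writeSLRTargetEnd (o : List ℤ) (ω : ℕ → Bool) :
    writeSLRTargetEnd.eval (outState (I.regs 0 I.d) I.encode o ω)
      = outState (I.regs 0 0) I.encode
          (o ++ [24 * (I.d : ℤ), 1, 24 * I.d, 1, I.d - 1, 1]) ω := by
  simp [writeSLRTargetEnd, Prog.eval, eval_emit, Expr.val, regs]

theorem eval_writeSLREntry {c l : ℕ} (hc : c < I.n + I.n) (hl : l < I.d) (o : List ℤ)
    (ω : ℕ → Bool) : writeSLREntry.eval (outState (I.regs c l) I.encode o ω)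
      = outState (I.regs c (l + 1)) I.encode (o ++ [4 * ((I.bit c l).toNat : ℤ), 1]) ω := by
  have hread : (readInput (.add (.const 2) (.add (.mul (.reg 4) (.reg 2)) (.reg 5)))).val
      (outState (I.regs c l) I.encode o ω) = (I.bit c l).toNat := by
    rw [val_readInput (k := 2 + (c * I.d + l)) (by simp [Expr.val, regs]), I.padded_encode hc hl]
  simp only [writeSLREntry, Prog.eval, eval_emit, Expr.val, hread]
  simp [regs]

theorem eval_writeSLRColumnEnd (c : ℕ) (o : List ℤ) (ω : ℕ → Bool) :
    writeSLRColumnEnd.eval (outState (I.regs c I.d) I.encode o ω)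
      = outState (I.regs (c + 1) 0) I.encode (o ++ I.slrColumnEnd c) ω := by
  by_cases hc : c < I.n <;>
    simp [writeSLRColumnEnd, Prog.eval, eval_emit, Expr.val, regs, slrColumnEnd, hc]

theorem writes_rows {g : ℕ → List ℤ} {p : Prog} (hp : p.IsBlock) {c : ℕ} (hc : c ≤ I.n + I.n)
    (heval : ∀ l < I.d, ∀ o ω, p.eval (outState (I.regs c l) I.encode o ω)
      = outState (I.regs c (l + 1)) I.encode (o ++ g l) ω) :
    Writes I.bound (I.d + 1) I.encode I.toSLR.encode (.loop (.sub (.reg 2) (.reg 5)) p)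
      (I.regs c 0) (I.regs c I.d) ((List.range I.d).flatMap g) := by
  rw [← mul_one (I.d + 1)]
  exact Writes.loop I.fits le_rfl (I.regs c) g I.d (fun _ hl => I.natAbs_le_of_mem_regs hc hl)
    (fun l hl o ω => by simpa [Expr.val, regs] using hl) (fun o ω => by simp [Expr.val, regs])
    fun l hl => .block I.fits hp (I.natAbs_le_of_mem_regs hc hl.le) (heval l hl)

theorem writes_target : Writes I.bound (I.d + 1) I.encode I.toSLR.encode writeSLRTarget
    (I.regs 0 0) (I.regs 0 0) I.slrTargetCode :=
  (I.writes_rows isBlock_writeSLRTwo (Nat.zero_le _) fun l _ => I.eval_writeSLRTwo l).seq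
    ((Writes.block I.fits isBlock_writeSLRTargetEnd
      (I.natAbs_le_of_mem_regs (Nat.zero_le _) le_rfl) I.eval_writeSLRTargetEnd).mono (by omega))

theorem writes_column {c : ℕ} (hc : c < I.n + I.n) :
    Writes I.bound (I.d + 1) I.encode I.toSLR.encode writeSLRColumn (I.regs c 0)
      (I.regs (c + 1) 0) (I.slrColumnCode c) :=
  (I.writes_rows isBlock_writeSLREntry hc.le fun _ => I.eval_writeSLREntry hc).seq
    ((Writes.block I.fits isBlock_writeSLRColumnEnd (I.natAbs_le_of_mem_regs hc.le le_rfl)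
      (I.eval_writeSLRColumnEnd c)).mono (by omega))

theorem writes_columns : Writes I.bound ((I.n + I.n + 1) * (I.d + 1)) I.encode I.toSLR.encode
    (.loop (.sub (.add (.reg 1) (.reg 1)) (.reg 4)) writeSLRColumn) (I.regs 0 0)
    (I.regs (I.n + I.n) 0) ((List.range (I.n + I.n)).flatMap I.slrColumnCode) :=
  Writes.loop I.fits (by omega) (I.regs · 0) I.slrColumnCode (I.n + I.n)
    (fun _ hc => I.natAbs_le_of_mem_regs hc (Nat.zero_le _))
    (fun c hc o ω => by simpa [Expr.val, regs] using mod_cast hc)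
    (fun o ω => by simp [Expr.val, regs])
    fun _ hc => I.writes_column hc

theorem writes_toSLR : Writes I.bound (6 * (I.n * I.d)) I.encode I.toSLR.encode writeSLR
    (I.regs 0 0) (I.regs (I.n + I.n) 0) I.toSLR.encode := by
  have hn := I.n_pos
  have hd := I.d_pos
  have hhead : Writes I.bound 1 I.encode I.toSLR.encode writeSLRHead (I.regs 0 0) (I.regs 0 0)
      I.slrHead := .block I.fits isBlock_writeSLRHead
    (I.natAbs_le_of_mem_regs (Nat.zero_le _) (Nat.zero_le _)) I.eval_writeSLRHead
  have hwrite := (hhead.mono (by nlinarith)).seq ((I.writes_target.mono (by nlinarith)).seq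
    (I.writes_columns.mono (N' := 6 * (I.n * I.d)) (by nlinarith)))
  rwa [← I.encode_toSLR] at hwrite

theorem runs_toSLR (ω : ℕ → Bool) : Runs I.bound (6 * (I.n * I.d)) (transduce 6 ovSetup writeSLR)
    (initState I.encode ω) (initState I.toSLR.encode ω) := by
  have hlen := I.length_encode_le
  have hpos := Nat.mul_pos I.n_pos I.d_pos
  refine Runs.transduce I.fits (l := [0]) (l' := [0]) (by omega) ?_ ?_ (by simp)
    ((I.runs_ovSetup ω).mono (by omega)) I.writes_toSLR
  · have := I.natAbs_le_of_mem_regs (Nat.zero_le _) (Nat.zero_le _)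
    simp only [regs, List.forall_mem_cons] at this ⊢
    exact ⟨this.1, this.2.1, by simp⟩
  · have := I.natAbs_le_of_mem_regs le_rfl (Nat.zero_le _)
    simp only [regs, List.forall_mem_cons] at this ⊢
    exact ⟨this.1, this.2.1, this.2.2.2.1, by simp⟩

end OVInstance

/-! ### Running time of the reduction to sparse regression -/

theorem sq_succ_le_four_mul_two_pow (s : ℕ) : (s + 1) ^ 2 ≤ 4 * 2 ^ s := by
  have hlt : ∀ s : ℕ, s + 1 < 2 ^ (s + 1) := fun s => Nat.lt_two_pow_self
  induction s using Nat.twoStepInduction with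
  | zero => norm_num
  | one => norm_num
  | more s ih _ =>
    have := hlt s
    rw [pow_succ] at this
    rw [pow_add]
    nlinarith

theorem size_sq_le {m : ℕ} (hm : 1 ≤ m) : m.size ^ 2 ≤ 4 * m := by
  obtain ⟨s, hs⟩ := Nat.exists_eq_add_of_le' (Nat.size_pos.2 hm)
  calc m.size ^ 2 = (s + 1) ^ 2 := by rw [hs]
    _ ≤ 4 * 2 ^ s := sq_succ_le_four_mul_two_pow s
    _ ≤ 4 * m := Nat.mul_le_mul_left 4 (Nat.lt_size.1 (by omega))

theorem size_le_two_mul_sqrt {m : ℕ} (hm : 1 ≤ m) : (m.size : ℝ) ≤ 2 * √m := by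
  refine le_of_sq_le_sq ?_ (by positivity)
  rw [mul_pow, Real.sq_sqrt m.cast_nonneg]
  exact_mod_cast (size_sq_le hm).trans_eq (by norm_num)

theorem mul_sqrt_le_rpow_two_sub {x ε : ℝ} (hx : 1 ≤ x) (hε : ε ≤ 1 / 2) :
    x * √x ≤ x ^ (2 - ε) := by
  calc x * √x = x ^ ((1 : ℝ) + 1 / 2) := by
        rw [Real.rpow_add (by linarith), Real.rpow_one, Real.sqrt_eq_rpow]
    _ ≤ x ^ (2 - ε) := Real.rpow_le_rpow_of_exponent_le hx (by linarith)

theorem two_mul_rpow_two_sub_le {x ε ε' : ℝ} (hx : 1 ≤ x) (hε' : 0 ≤ ε') (hε : ε' ≤ ε) :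
    (2 * x) ^ (2 - ε) ≤ 4 * x ^ (2 - ε') := by
  calc (2 * x) ^ (2 - ε) ≤ (2 * x) ^ (2 - ε') :=
        Real.rpow_le_rpow_of_exponent_le (by linarith) (by linarith)
    _ = 2 ^ (2 - ε') * x ^ (2 - ε') := Real.mul_rpow (by norm_num) (by linarith)
    _ ≤ 2 ^ (2 : ℝ) * x ^ (2 - ε') := by
      gcongr
      · norm_num
      · linarith
    _ = 4 * x ^ (2 - ε') := by norm_num

namespace OVInstance

variable (I : OVInstance)

theorem one_le_cast_n : (1 : ℝ) ≤ I.n := by exact_mod_cast I.n_pos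

theorem one_le_cast_d : (1 : ℝ) ≤ I.d := by exact_mod_cast I.d_pos

theorem size_bound_le : (I.bound.size : ℝ) ≤ 20 * (√I.n * I.d) := by
  have hd : √(I.d : ℝ) ≤ I.d := Real.sqrt_le_self_iff.2 (.inr I.one_le_cast_d)
  have hsqrt : √(100 : ℝ) = 10 := by rw [Real.sqrt_eq_iff_mul_self_eq] <;> norm_num
  calc (I.bound.size : ℝ) ≤ 2 * √(I.bound : ℝ) := size_le_two_mul_sqrt I.fits.one_le
    _ = 20 * (√I.n * √I.d) := by
      rw [bound, Nat.cast_mul, Nat.cast_mul, Real.sqrt_mul (by positivity),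
        Real.sqrt_mul (by positivity), Nat.cast_ofNat, hsqrt]
      ring
    _ ≤ 20 * (√I.n * I.d) := by gcongr

theorem reduction_time_le {ε : ℝ} (hε : ε ≤ 1 / 2) (c : ℕ) :
    ((6 * (I.n * I.d) : ℕ) : ℝ) * I.bound.size
      ≤ 120 * (I.n : ℝ) ^ (2 - ε) * (I.d : ℝ) ^ (2 * c + 2) := by
  have hsize := I.size_bound_le
  have hn := mul_sqrt_le_rpow_two_sub I.one_le_cast_n hε
  calc ((6 * (I.n * I.d) : ℕ) : ℝ) * I.bound.size
      ≤ ((6 * (I.n * I.d) : ℕ) : ℝ) * (20 * (√I.n * I.d)) := by gcongr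
    _ = 120 * (I.n * √I.n) * (I.d : ℝ) ^ 2 := by push_cast; ring
    _ ≤ 120 * (I.n : ℝ) ^ (2 - ε) * (I.d : ℝ) ^ (2 * c + 2) := by
      gcongr
      · exact I.one_le_cast_d
      · omega

theorem toSLR_d_mul_bits_pow_le (c : ℕ) :
    ((I.toSLR.d : ℝ) * (I.toSLR.bits : ℝ)) ^ c ≤ 96 ^ c * (I.d : ℝ) ^ (2 * c + 2) := by
  have hd := I.one_le_cast_d
  have hbits : (I.toSLR.bits : ℝ) ≤ 24 * I.d := by exact_mod_cast I.bits_toSLR_le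
  have hdim : (I.toSLR.d : ℝ) ≤ 4 * I.d := by
    simp only [toSLR, Nat.cast_add, Nat.cast_ofNat]
    linarith
  calc ((I.toSLR.d : ℝ) * (I.toSLR.bits : ℝ)) ^ c ≤ (4 * I.d * (24 * I.d)) ^ c := by gcongr
    _ = 96 ^ c * (I.d : ℝ) ^ (2 * c) := by rw [pow_mul, ← mul_pow]; ring
    _ ≤ 96 ^ c * (I.d : ℝ) ^ (2 * c + 2) := by
      gcongr
      omega

theorem toSLR_n_rpow_le {ε ε' : ℝ} (hε' : 0 ≤ ε') (hε : ε' ≤ ε) :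
    (I.toSLR.n : ℝ) ^ (2 - ε) ≤ 4 * (I.n : ℝ) ^ (2 - ε') := by
  have hn : (I.toSLR.n : ℝ) = 2 * I.n := by rw [toSLR, Nat.cast_add, two_mul]
  rw [hn]
  exact two_mul_rpow_two_sub_le I.one_le_cast_n hε' hε

end OVInstance

theorem ov_solvable_of_slr {ε C : ℝ} {c : ℕ} (hε : 0 < ε)
    (h : (SLR 2).SolvableInTime fun I : SLRInstance =>
      C * (I.n : ℝ) ^ (2 - ε) * ((I.d : ℝ) * (I.bits : ℝ)) ^ c) :
    ∃ ε' : ℝ, 0 < ε' ∧ ε' ≤ 1 ∧ ∃ (C' : ℝ) (c' : ℕ), 0 ≤ C' ∧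
      OV.SolvableInTime fun I : OVInstance => C' * (I.n : ℝ) ^ (2 - ε') * (I.d : ℝ) ^ c' := by
  let R := transduce 6 ovSetup writeSLR
  have hε' : 0 < min ε (1 / 2) := by positivity
  refine ⟨min ε (1 / 2), hε', (min_le_right _ _).trans (by norm_num),
    120 * R.weight + 4 * |C| * 96 ^ c, 2 * c + 2, by positivity, ?_⟩
  refine (h.of_reduction (P := OV) OVInstance.toSLR OVInstance.toSLR_isYes_iff
    OVInstance.runs_toSLR).mono fun I : OVInstance => ?_
  have hR : (R.weight : ℝ) * (((6 * (I.n * I.d) : ℕ) : ℝ) * I.bound.size)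
      ≤ R.weight * (120 * (I.n : ℝ) ^ (2 - min ε (1 / 2)) * (I.d : ℝ) ^ (2 * c + 2)) :=
    mul_le_mul_of_nonneg_left (I.reduction_time_le (min_le_right _ _) c) (Nat.cast_nonneg _)
  have hC : C * (I.toSLR.n : ℝ) ^ (2 - ε) * ((I.toSLR.d : ℝ) * (I.toSLR.bits : ℝ)) ^ c
      ≤ |C| * (4 * (I.n : ℝ) ^ (2 - min ε (1 / 2))) * (96 ^ c * (I.d : ℝ) ^ (2 * c + 2)) := by
    gcongr
    · exact le_abs_self C
    · exact I.toSLR_n_rpow_le hε'.le (min_le_left _ _)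
    · exact I.toSLR_d_mul_bits_pow_le c
  exact (add_le_add hR hC).trans_eq (by ring)

/-! ### Satisfiability as Orthogonal Vectors -/

/-- Whether the assignment that is given by the bits of `a` to the variables of parity `side` does
not satisfy the clause `c`. -/
def unsatBy {n : ℕ} (side a : ℕ) (c : List (Fin n × Bool)) : Bool :=
  c.all fun l => !(decide ((l.1 : ℕ) % 2 = side) && a.testBit (l.1 / 2) == l.2)

/-- The number of variables of even index; there are at most as many of odd index. -/
def KCNF.half {k : ℕ} (φ : KCNF k) : ℕ := (φ.n + 1) / 2

/-- The instance of Orthogonal Vectors for a formula. The vectors of `U` are given by assignments of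
the variables of even index, those of `V` by assignments of the variables of odd index. There is a
coordinate for every clause, and one more, since the dimension has to be positive. -/
def KCNF.toOV {k : ℕ} (φ : KCNF k) : OVInstance where
  n := 2 ^ φ.half
  d := φ.clauses.length + 1
  n_pos := by positivity
  d_pos := by omega
  U := fun a j => (φ.clauses[(j : ℕ)]?.map (unsatBy 0 a)).getD false
  V := fun a j => (φ.clauses[(j : ℕ)]?.map (unsatBy 1 a)).getD false

theorem unsatBy_eq_false_iff {n side a : ℕ} {c : List (Fin n × Bool)} :
    unsatBy side a c = false ↔ ∃ l ∈ c, (l.1 : ℕ) % 2 = side ∧ a.testBit (l.1 / 2) = l.2 := by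
  simp [unsatBy]

theorem exists_lt_two_pow_testBit_eq (h : ℕ) (β : ℕ → Bool) :
    ∃ a < 2 ^ h, ∀ i < h, a.testBit i = β i :=
  ⟨_, Nat.ofBits_lt_two_pow fun i : Fin h => β i, fun i hi => Nat.testBit_ofBits_lt _ i hi⟩

section

variable {k : ℕ} (φ : KCNF k)

theorem KCNF.toOV_isYes_iff_exists_lt : φ.toOV.IsYes ↔ ∃ a < 2 ^ φ.half, ∃ b < 2 ^ φ.half,
    ∀ c ∈ φ.clauses, unsatBy 0 a c = false ∨ unsatBy 1 b c = false := by
  constructor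
  · rintro ⟨a, b, hab⟩
    refine ⟨a, a.2, b, b.2, fun c hc => ?_⟩
    obtain ⟨j, hj, rfl⟩ := List.getElem_of_mem hc
    have hzero := Finset.sum_eq_zero_iff.1 hab ⟨j, Nat.lt_succ_of_lt hj⟩ (Finset.mem_univ _)
    simpa [KCNF.toOV, hj] using hzero
  · rintro ⟨a, ha, b, hb, hab⟩
    refine ⟨⟨a, ha⟩, ⟨b, hb⟩, Finset.sum_eq_zero fun j _ => ?_⟩
    rcases lt_or_ge (j : ℕ) φ.clauses.length with hj | hj
    · simpa [KCNF.toOV, hj] using hab _ (List.getElem_mem hj)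
    · simp [KCNF.toOV, hj]

theorem KCNF.satisfiable_iff_exists_lt : φ.Satisfiable ↔ ∃ a < 2 ^ φ.half, ∃ b < 2 ^ φ.half,
    ∀ c ∈ φ.clauses, unsatBy 0 a c = false ∨ unsatBy 1 b c = false := by
  simp only [unsatBy_eq_false_iff]
  constructor
  · rintro ⟨α, hα⟩
    let β (i : ℕ) : Bool := if hi : i < φ.n then α ⟨i, hi⟩ else false
    have hβ (i : Fin φ.n) : β i = α i := dif_pos i.2
    obtain ⟨a, ha, hβa⟩ := exists_lt_two_pow_testBit_eq φ.half fun i => β (2 * i)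
    obtain ⟨b, hb, hβb⟩ := exists_lt_two_pow_testBit_eq φ.half fun i => β (2 * i + 1)
    have hhalf (i : Fin φ.n) : (i : ℕ) / 2 < φ.half := by rw [KCNF.half]; omega
    refine ⟨a, ha, b, hb, fun c hc => ?_⟩
    obtain ⟨l, hl, hsat⟩ := hα c hc
    rcases Nat.mod_two_eq_zero_or_one l.1 with heven | hodd
    · refine .inl ⟨l, hl, heven, ?_⟩
      rw [hβa _ (hhalf l.1), ← hsat, ← hβ, show 2 * ((l.1 : ℕ) / 2) = l.1 by omega]
    · refine .inr ⟨l, hl, hodd, ?_⟩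
      rw [hβb _ (hhalf l.1), ← hsat, ← hβ, show 2 * ((l.1 : ℕ) / 2) + 1 = l.1 by omega]
  · rintro ⟨a, -, b, -, hab⟩
    refine ⟨fun i => if (i : ℕ) % 2 = 0 then a.testBit (i / 2) else b.testBit (i / 2),
      fun c hc => ?_⟩
    rcases hab c hc with ⟨l, hl, hside, hbit⟩ | ⟨l, hl, hside, hbit⟩ <;>
      exact ⟨l, hl, by simp [hside, hbit]⟩

theorem KCNF.toOV_isYes_iff : φ.toOV.IsYes ↔ φ.Satisfiable :=
  φ.toOV_isYes_iff_exists_lt.trans φ.satisfiable_iff_exists_lt.symm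

theorem KCNF.length_clauses_le : φ.clauses.length ≤ (2 * φ.n + 1) ^ k := by
  classical
  have hcard : Fintype.card (Fin k → Option (Fin φ.n × Bool)) = (2 * φ.n + 1) ^ k := by
    simp [mul_comm]
  rw [← List.toFinset_card_of_nodup φ.nodup, ← hcard, ← Finset.card_univ]
  refine Finset.card_le_card_of_injOn (fun cl i => cl[(i : ℕ)]?) (by simp) ?_
  intro c hc c' hc' hcc'
  have hlen := φ.size_le c (by simpa using hc)
  have hlen' := φ.size_le c' (by simpa using hc')
  apply List.ext_getElem?
  intro i
  rcases lt_or_ge i k with hi | hi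
  · exact congrFun hcc' ⟨i, hi⟩
  · rw [List.getElem?_eq_none (by omega), List.getElem?_eq_none (by omega)]

end

/-! ### The encoding of a formula -/

/-- The code of a clause in the encoding of a formula. -/
def encodeClause {n : ℕ} (c : List (Fin n × Bool)) : List ℤ := (c.length : ℤ) :: c.map encodeLit

theorem length_encodeClause {n : ℕ} (c : List (Fin n × Bool)) :
    (encodeClause c).length = c.length + 1 := by simp [encodeClause]

theorem natAbs_encodeLit_le {n : ℕ} (l : Fin n × Bool) : (encodeLit l).natAbs ≤ n := by
  have := l.1.2
  rw [encodeLit]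
  split_ifs <;> omega

namespace KCNF

variable {k : ℕ} (φ : KCNF k)

/-- The position in the encoding of a formula at which the code of its `j`-th clause begins. -/
def pos (j : ℕ) : ℕ := 2 + ((φ.clauses.take j).flatMap encodeClause).length

theorem encode_eq : φ.encode =
    [(φ.n : ℤ), (φ.clauses.length : ℤ)] ++ φ.clauses.flatMap encodeClause := by
  rw [List.flatMap_def]
  rfl

theorem pos_zero : φ.pos 0 = 2 := by simp [pos]

theorem pos_length : φ.pos φ.clauses.length = φ.encode.length := by
  rw [pos, List.take_length, encode_eq, List.length_append]
  rfl

theorem pos_succ {j : ℕ} (hj : j < φ.clauses.length) :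
    φ.pos (j + 1) = φ.pos j + 1 + φ.clauses[j].length := by
  rw [pos, pos, List.take_add_one, List.getElem?_eq_getElem hj, List.flatMap_append,
    List.length_append, Option.toList_some, List.flatMap_singleton, length_encodeClause]
  omega

theorem pos_le (j : ℕ) : φ.pos j ≤ φ.encode.length := by
  rw [← pos_length, pos, pos, List.take_length]
  exact Nat.add_le_add_left ((List.take_sublist _ _).flatMap encodeClause).length_le 2

theorem padded_encode_pos_add {j : ℕ} (hj : j < φ.clauses.length) {t : ℕ}
    (ht : t ≤ φ.clauses[j].length) :
    padded φ.encode (φ.pos j + t) = padded (encodeClause φ.clauses[j]) t := by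
  have hsplit : φ.encode = ([(φ.n : ℤ), (φ.clauses.length : ℤ)] ++
      (φ.clauses.take j).flatMap encodeClause) ++ (encodeClause φ.clauses[j] ++
        (φ.clauses.drop (j + 1)).flatMap encodeClause) := by
    rw [encode_eq, List.append_assoc, ← List.flatMap_cons, ← List.drop_eq_getElem_cons hj,
      ← List.flatMap_append, List.take_append_drop]
  have hlen : ([(φ.n : ℤ), (φ.clauses.length : ℤ)] ++
      (φ.clauses.take j).flatMap encodeClause).length = φ.pos j := List.length_append
  rw [hsplit, ← hlen, padded_append_length_add, padded, padded, List.getD_append]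
  rw [length_encodeClause]
  omega

theorem padded_encode_pos {j : ℕ} (hj : j < φ.clauses.length) :
    padded φ.encode (φ.pos j) = φ.clauses[j].length := by
  simpa [encodeClause, padded] using φ.padded_encode_pos_add hj (Nat.zero_le _)

theorem padded_encode_pos_add_one_add {j : ℕ} (hj : j < φ.clauses.length) {t : ℕ}
    (ht : t < φ.clauses[j].length) :
    padded φ.encode (φ.pos j + 1 + t) = encodeLit φ.clauses[j][t] := by
  rw [add_assoc, add_comm 1 t, φ.padded_encode_pos_add hj ht]
  simp [encodeClause, padded, ht]

theorem length_encode_le : φ.encode.length ≤ 2 + φ.clauses.length * (k + 1) := by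
  rw [encode_eq, List.length_append, List.length_flatMap, ← smul_eq_mul φ.clauses.length,
    ← List.length_map (as := φ.clauses) (List.length ∘ encodeClause)]
  refine Nat.add_le_add_left (List.sum_le_card_nsmul _ _ fun v hv => ?_) 2
  obtain ⟨c, hc, rfl⟩ := List.mem_map.1 hv
  exact (length_encodeClause c).trans_le (Nat.succ_le_succ (φ.size_le c hc))

/-! ### The size of the instance of Orthogonal Vectors -/

/-- The cost of computing a vector. -/
def vecCost : ℕ := (φ.clauses.length + 1) * ((k + 1) * (φ.n + 1))

/-- A bound for all numbers that occur while the instance of Orthogonal Vectors is computed. -/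
def bound : ℕ := 4 * (2 ^ φ.half * φ.vecCost)

theorem four_mul_vecCost_le_bound : 4 * φ.vecCost ≤ φ.bound :=
  Nat.mul_le_mul_left _ (Nat.le_mul_of_pos_left _ (by positivity))

theorem length_clauses_lt_vecCost : φ.clauses.length < φ.vecCost :=
  Nat.le_mul_of_pos_right _ (by positivity)

theorem n_lt_vecCost : φ.n < φ.vecCost :=
  (Nat.le_mul_of_pos_left _ k.succ_pos).trans (Nat.le_mul_of_pos_left _ (by positivity))

theorem k_lt_vecCost : k < φ.vecCost :=
  (Nat.le_mul_of_pos_right _ φ.n.succ_pos).trans (Nat.le_mul_of_pos_left _ (by positivity))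

theorem length_encode_le_vecCost : φ.encode.length ≤ 1 + φ.vecCost := by
  have hlen := φ.length_encode_le
  rw [vecCost]
  nlinarith [Nat.zero_le (φ.n * (φ.clauses.length * k + φ.clauses.length + k + 1))]

theorem two_pow_half_mul_le_bound :
    2 * (2 ^ φ.half * (φ.clauses.length + 1)) + 2 * 2 ^ φ.half ≤ φ.bound := by
  have hm : 2 ^ φ.half * (φ.clauses.length + 1) ≤ 2 ^ φ.half * φ.vecCost :=
    Nat.mul_le_mul_left _ φ.length_clauses_lt_vecCost
  have hone : 2 ^ φ.half ≤ 2 ^ φ.half * (φ.clauses.length + 1) :=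
    Nat.le_mul_of_pos_right _ (by positivity)
  rw [bound]
  omega

theorem two_mul_two_pow_half_le_bound : 2 * 2 ^ φ.half ≤ φ.bound :=
  (Nat.le_add_left _ _).trans φ.two_pow_half_mul_le_bound

theorem natAbs_le_of_mem_encode {v : ℤ} (hv : v ∈ φ.encode) : v.natAbs ≤ φ.bound := by
  have hbound := φ.four_mul_vecCost_le_bound
  have hn := φ.n_lt_vecCost
  have hm := φ.length_clauses_lt_vecCost
  have hk := φ.k_lt_vecCost
  rw [encode_eq] at hv
  simp only [List.mem_append, List.mem_cons, List.not_mem_nil, or_false, List.mem_flatMap,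
    encodeClause, List.mem_map] at hv
  rcases hv with (rfl | rfl) | ⟨c, hc, rfl | ⟨l, -, rfl⟩⟩
  · omega
  · omega
  · have := φ.size_le c hc
    omega
  · have := natAbs_encodeLit_le l
    omega

theorem natAbs_le_of_mem_encode_toOV {v : ℤ} (hv : v ∈ φ.toOV.encode) : v.natAbs ≤ φ.bound := by
  have hbound := φ.four_mul_vecCost_le_bound
  have hm := φ.length_clauses_lt_vecCost
  have hpow := φ.two_mul_two_pow_half_le_bound
  rw [φ.toOV.encode_eq] at hv
  simp only [List.mem_append, List.mem_flatMap, List.mem_map, List.mem_cons, List.not_mem_nil,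
    or_false] at hv
  rcases hv with (rfl | rfl) | ⟨c, -, l, -, rfl⟩
  · exact le_trans (Nat.le_mul_of_pos_left _ two_pos) hpow
  · exact hm.trans_le (by omega)
  · have := φ.toOV.bit_natAbs_le c l
    omega

theorem length_encode_toOV_le : φ.toOV.encode.length ≤ φ.bound := by
  have hpow : 1 ≤ 2 ^ φ.half := Nat.one_le_two_pow
  have hbound := φ.two_pow_half_mul_le_bound
  rw [φ.toOV.length_encode, add_mul]
  change 2 + (2 ^ φ.half * (φ.clauses.length + 1) + 2 ^ φ.half * (φ.clauses.length + 1)) ≤ _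
  omega

theorem fits : Fits φ.bound φ.encode φ.toOV.encode where
  one_le := by
    have := φ.four_mul_vecCost_le_bound
    have := φ.n_lt_vecCost
    omega
  input _ := φ.natAbs_le_of_mem_encode
  input_length := by
    have := φ.four_mul_vecCost_le_bound
    have := φ.length_encode_le_vecCost
    have := φ.n_lt_vecCost
    omega
  output _ := φ.natAbs_le_of_mem_encode_toOV
  output_length := φ.length_encode_toOV_le

theorem bit_toOV {A j : ℕ} (hA : A < 2 * 2 ^ φ.half) (hj : j < φ.clauses.length) :
    φ.toOV.bit A j = unsatBy (A / 2 ^ φ.half) (A % 2 ^ φ.half) φ.clauses[j] := by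
  have hjd : j < φ.toOV.d := Nat.lt_succ_of_lt hj
  rw [OVInstance.bit, dif_pos hjd]
  split_ifs with hU hV
  · have hA' : A < 2 ^ φ.half := hU
    simp [toOV, hj, Nat.div_eq_of_lt hA', Nat.mod_eq_of_lt hA']
  · have hA' : 2 ^ φ.half ≤ A := not_lt.1 hU
    have hdiv : A / 2 ^ φ.half = 1 := Nat.div_eq_of_lt_le (by omega) (by omega)
    have hmod : A % 2 ^ φ.half = A - 2 ^ φ.half := by
      rw [Nat.mod_eq_sub_mod hA', Nat.mod_eq_of_lt (by omega)]
    rw [hdiv, hmod]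
    simp [toOV, hj]
  · exact absurd (show A - 2 ^ φ.half < 2 ^ φ.half by omega) hV

theorem bit_toOV_last (A : ℕ) : φ.toOV.bit A φ.clauses.length = false := by
  rw [OVInstance.bit]
  split_ifs <;> simp [toOV]

end KCNF

/-! ### A program for the reduction to Orthogonal Vectors -/

/-- The contents of the registers from 1 on in the program for the reduction to Orthogonal Vectors,
in the order of the fields: the numbers of variables and clauses and the length of the input; the
number of the vector being computed, and the number of vectors on each side; the side and the
assignment to which that vector belongs; the number of clauses left and the position in the input;
whether the clause has no literal yet that the assignment satisfies, and the number of its literals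
left; the variable of the literal, the assignment without the bits already passed over, and the sign
of the literal. -/
structure SatRegs where
  vars : ℤ := 0
  clauses : ℤ := 0
  inputLength : ℤ := 0
  vec : ℤ := 0
  pow : ℤ := 0
  side : ℤ := 0
  asg : ℤ := 0
  clausesLeft : ℤ := 0
  ptr : ℤ := 0
  flag : ℤ := 0
  litsLeft : ℤ := 0
  var : ℤ := 0
  shifted : ℤ := 0
  sign : ℤ := 0

/-- The registers from 1 on, as a list. -/
def SatRegs.toList (r : SatRegs) : List ℤ :=
  [r.vars, r.clauses, r.inputLength, r.vec, r.pow, r.side, r.asg, r.clausesLeft, r.ptr, r.flag,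
    r.litsLeft, r.var, r.shifted, r.sign]

/-- Reads the numbers of variables and of clauses. -/
def satReadSizes : Prog :=
  .seq (.assign 1 (.load (.const 0))) (.seq (.assign 2 (.load (.const 1)))
    (.seq (.assign 3 (.const 2)) (.assign 8 (.reg 2))))

/-- Skips a clause, register 3 being the position in the input. -/
def satSkipClause : Prog :=
  .seq (.assign 3 (.add (.reg 3) (.add (.const 1) (.load (.reg 3)))))
    (.assign 8 (.sub (.reg 8) (.const 1)))

/-- Reads the numbers of variables and of clauses and computes the length of the input. -/
def satSetup : Prog := .seq satReadSizes (.loop (.reg 8) satSkipClause)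

/-- Prepares the computation of the number of vectors on each side. -/
def satPowStart : Prog := .seq (.assign 5 (.const 1)) (.assign 12 (.reg 1))

/-- Doubles register 5 for two variables. -/
def satDouble : Prog :=
  .seq (.assign 5 (.mul (.reg 5) (.const 2))) (.assign 12 (.sub (.reg 12) (.const 2)))

/-- Writes the number and the dimension of the vectors. -/
def satWriteHead : Prog :=
  .seq (.assign 12 (.const 0)) (.seq (emit (.reg 5)) (emit (.add (.reg 2) (.const 1))))

/-- Decodes a literal. -/
def satReadLit : Prog :=
  .seq (.ite (readInput (.reg 9))
      (.seq (.assign 12 (.sub (readInput (.reg 9)) (.const 1))) (.assign 14 (.const 1)))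
      (.seq (.assign 12 (.sub (.const (-1)) (readInput (.reg 9)))) (.assign 14 (.const 0))))
    (.assign 13 (.reg 7))

/-- Passes over a bit of the assignment. -/
def satHalve : Prog :=
  .seq (.assign 12 (.sub (.reg 12) (.const 2))) (.assign 13 (.div (.reg 13) (.const 2)))

/-- The value `1 - (e - f) ^ 2`, which for two bits says whether they are equal. -/
def Expr.eqTest (e f : Expr) : Expr := .sub (.const 1) (.mul (.sub e f) (.sub e f))

/-- Clears the flag if the assignment satisfies the literal. -/
def satUseLit : Prog :=
  .seq (.assign 10 (.mul (.reg 10) (.sub (.const 1) (.mul (.eqTest (.reg 12) (.reg 6))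
      (.eqTest (.reg 14) (.sub (.reg 13) (.mul (.const 2) (.div (.reg 13) (.const 2)))))))))
    (.seq (.assign 12 (.const 0)) (.seq (.assign 13 (.const 0)) (.seq (.assign 14 (.const 0))
      (.seq (.assign 9 (.add (.reg 9) (.const 1))) (.assign 11 (.sub (.reg 11) (.const 1)))))))

/-- Handles a literal. -/
def satLit : Prog :=
  .seq satReadLit (.seq (.loop (.sub (.reg 12) (.const 1)) satHalve) satUseLit)

/-- Reads the length of a clause. -/
def satClauseStart : Prog :=
  .seq (.assign 10 (.const 1)) (.seq (.assign 11 (readInput (.reg 9)))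
    (.assign 9 (.add (.reg 9) (.const 1))))

/-- Writes the coordinate for a clause. -/
def satClauseEnd : Prog :=
  .seq (emit (.reg 10)) (.seq (.assign 10 (.const 0)) (.assign 8 (.sub (.reg 8) (.const 1))))

/-- Handles a clause. -/
def satClause : Prog := .seq satClauseStart (.seq (.loop (.reg 11) satLit) satClauseEnd)

/-- Decodes the number of a vector. -/
def satVecStart : Prog :=
  .seq (.assign 6 (.div (.reg 4) (.reg 5)))
    (.seq (.assign 7 (.sub (.reg 4) (.mul (.reg 5) (.reg 6))))
      (.seq (.assign 8 (.reg 2)) (.assign 9 (.const 2))))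

/-- Writes the last coordinate of a vector. -/
def satVecEnd : Prog :=
  .seq (emit (.const 0)) (.seq (.assign 4 (.add (.reg 4) (.const 1)))
    (.seq (.assign 6 (.const 0)) (.seq (.assign 7 (.const 0)) (.assign 9 (.const 0)))))

/-- Writes a vector. -/
def satVec : Prog := .seq satVecStart (.seq (.loop (.reg 8) satClause) satVecEnd)

/-- Writes the instance of Orthogonal Vectors. -/
def satWriteOV : Prog :=
  .seq (.seq satPowStart (.seq (.loop (.reg 12) satDouble) satWriteHead))
    (.loop (.sub (.add (.reg 5) (.reg 5)) (.reg 4)) satVec)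

section

variable (r : SatRegs) (x o : List ℤ) (ω : ℕ → Bool)

theorem isBlock_satWriteHead : satWriteHead.IsBlock := by
  simp [satWriteHead, Prog.IsBlock, isBlock_emit]

theorem isBlock_satReadLit : satReadLit.IsBlock := by simp [satReadLit, Prog.IsBlock]

theorem isBlock_satUseLit : satUseLit.IsBlock := by simp [satUseLit, Prog.IsBlock]

theorem isBlock_satClauseEnd : satClauseEnd.IsBlock := by
  simp [satClauseEnd, Prog.IsBlock, isBlock_emit]

theorem isBlock_satVecEnd : satVecEnd.IsBlock := by
  simp [satVecEnd, Prog.IsBlock, isBlock_emit]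

theorem eval_satPowStart : satPowStart.eval (outState r.toList x o ω)
    = outState { r with pow := 1, var := r.vars }.toList x o ω := by
  simp [satPowStart, Prog.eval, Expr.val, SatRegs.toList]

theorem eval_satDouble : satDouble.eval (outState r.toList x o ω)
    = outState { r with pow := r.pow * 2, var := r.var - 2 }.toList x o ω := by
  simp [satDouble, Prog.eval, Expr.val, SatRegs.toList]

theorem eval_satWriteHead : satWriteHead.eval (outState r.toList x o ω)
    = outState { r with var := 0 }.toList x (o ++ [r.pow, r.clauses + 1]) ω := by
  simp [satWriteHead, Prog.eval, eval_emit, Expr.val, SatRegs.toList]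

variable {r x} in
theorem eval_satReadLit {p n : ℕ} {l : Fin n × Bool} (hptr : r.ptr = p)
    (hx : padded x p = encodeLit l) : satReadLit.eval (outState r.toList x o ω)
      = outState { r with var := l.1, shifted := r.asg, sign := l.2.toNat }.toList x o ω := by
  have hread : (readInput (.reg 9)).val (outState r.toList x o ω) = encodeLit l := by
    rw [← hx]
    exact val_readInput hptr
  simp only [satReadLit, Prog.eval, Expr.val, hread]
  rcases l with ⟨i, _ | _⟩
  · rw [if_neg (by simp [encodeLit])]
    simp [encodeLit, SatRegs.toList]
  · rw [if_pos (by simp [encodeLit])]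
    simp [encodeLit, SatRegs.toList]

theorem eval_satHalve : satHalve.eval (outState r.toList x o ω)
    = outState { r with var := r.var - 2, shifted := r.shifted / 2 }.toList x o ω := by
  simp [satHalve, Prog.eval, Expr.val, SatRegs.toList]

variable {r} in
theorem eval_satUseLit {i y side : ℕ} {s u : Bool} (hflag : r.flag = u.toNat)
    (hvar : r.var = (i % 2 : ℕ)) (hside : r.side = side) (hlt : side < 2) (hsign : r.sign = s.toNat)
    (hshifted : r.shifted = y) : satUseLit.eval (outState r.toList x o ω) =
      outState { r with
        flag := (u && !(decide (i % 2 = side) && decide (y % 2 = 1) == s)).toNat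
        var := 0, shifted := 0, sign := 0, ptr := r.ptr + 1
        litsLeft := r.litsLeft - 1 }.toList x o ω := by
  have hflag' : r.flag * (1 - (1 - (r.var - r.side) * (r.var - r.side)) *
      (1 - (r.sign - (r.shifted - 2 * (r.shifted / 2))) *
        (r.sign - (r.shifted - 2 * (r.shifted / 2))))) =
      (u && !(decide (i % 2 = side) && decide (y % 2 = 1) == s)).toNat := by
    have hbit : (y : ℤ) - 2 * ((y : ℤ) / 2) = (y % 2 : ℕ) := by omega
    rw [hflag, hvar, hside, hsign, hshifted, hbit]
    rcases Nat.mod_two_eq_zero_or_one i with hi | hi <;>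
      rcases Nat.mod_two_eq_zero_or_one y with hy | hy <;>
      interval_cases side <;> cases u <;> cases s <;> simp [hi, hy]
  rw [← hflag']
  simp [satUseLit, Prog.eval, Expr.val, Expr.eqTest, SatRegs.toList]

variable {r} in
theorem eval_satClauseStart {p : ℕ} (hptr : r.ptr = p) :
    satClauseStart.eval (outState r.toList x o ω) = outState
      { r with flag := 1, litsLeft := padded x p, ptr := r.ptr + 1 }.toList x o ω := by
  have hread : (readInput (.reg 9)).val (outState { r with flag := 1 }.toList x o ω) = padded x p :=
    val_readInput hptr
  simp_all [satClauseStart, Prog.eval, Expr.val, SatRegs.toList]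

theorem eval_satClauseEnd : satClauseEnd.eval (outState r.toList x o ω)
    = outState { r with flag := 0, clausesLeft := r.clausesLeft - 1 }.toList x (o ++ [r.flag])
      ω := by
  simp [satClauseEnd, Prog.eval, eval_emit, Expr.val, SatRegs.toList]

theorem eval_satVecStart : satVecStart.eval (outState r.toList x o ω) =
    outState { r with side := r.vec / r.pow, asg := r.vec % r.pow, clausesLeft := r.clauses
                      ptr := 2 }.toList x o ω := by
  simp [satVecStart, Prog.eval, Expr.val, SatRegs.toList, Int.emod_def]

theorem eval_satVecEnd : satVecEnd.eval (outState r.toList x o ω) =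
    outState { r with vec := r.vec + 1, side := 0, asg := 0, ptr := 0 }.toList x (o ++ [0]) ω := by
  simp [satVecEnd, Prog.eval, eval_emit, Expr.val, SatRegs.toList]

theorem eval_satReadSizes (g : ℕ → ℤ) :
    satReadSizes.eval (tapeState (0 :: ({} : SatRegs).toList) 0 g ω) =
      tapeState (0 :: { vars := g 0, clauses := g 1, inputLength := 2,
                        clausesLeft := g 1 : SatRegs }.toList) 0 g ω := by
  have hn : splitMem 0 g 0 = g 0 := splitMem_natCast _ _ 0
  have hm : splitMem 0 g 1 = g 1 := splitMem_natCast _ _ 1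
  simp [satReadSizes, Prog.eval, Expr.val, SatRegs.toList, hn, hm]

variable {r} in
theorem eval_satSkipClause {p : ℕ} (hp : r.inputLength = p) (g : ℕ → ℤ) :
    satSkipClause.eval (tapeState (0 :: r.toList) 0 g ω) =
      tapeState (0 :: { r with inputLength := p + (1 + g p)
                               clausesLeft := r.clausesLeft - 1 }.toList) 0 g ω := by
  simp [satSkipClause, Prog.eval, Expr.val, SatRegs.toList, hp, splitMem_natCast]

end

namespace KCNF

variable {k : ℕ} (φ : KCNF k)

/-- The registers after the input has been moved. -/
def baseRegs : SatRegs :=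
  { vars := φ.n, clauses := φ.clauses.length, inputLength := φ.encode.length }

/-- The registers before vector `A` is written; the vectors of both sides are numbered
consecutively. -/
def vecRegs (A : ℕ) : SatRegs := { φ.baseRegs with pow := (2 ^ φ.half : ℕ), vec := A }

/-- The registers before the coordinate of vector `A` for clause `j` is computed. -/
def clauseRegs (A j : ℕ) : SatRegs :=
  { φ.vecRegs A with
    side := (A / 2 ^ φ.half : ℕ)
    asg := (A % 2 ^ φ.half : ℕ)
    clausesLeft := φ.clauses.length - j
    ptr := φ.pos j }

/-- The registers before literal `t` of clause `j` is handled for vector `A`. -/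
def litRegs (A : ℕ) {j : ℕ} (hj : j < φ.clauses.length) (t : ℕ) : SatRegs :=
  { φ.clauseRegs A j with
    ptr := (φ.pos j + 1 + t : ℕ)
    flag := (unsatBy (A / 2 ^ φ.half) (A % 2 ^ φ.half) (φ.clauses[j].take t)).toNat
    litsLeft := φ.clauses[j].length - t }

theorem natAbs_le_of_mem_baseRegs : ∀ v ∈ φ.baseRegs.toList, v.natAbs ≤ φ.bound := by
  have hbound := φ.four_mul_vecCost_le_bound
  have hn := φ.n_lt_vecCost
  have hm := φ.length_clauses_lt_vecCost
  have hlen := φ.fits.input_length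
  simp only [SatRegs.toList, baseRegs, List.forall_mem_cons, List.not_mem_nil, IsEmpty.forall_iff,
    implies_true, and_true]
  omega

theorem natAbs_le_of_mem_powRegs {i : ℕ} (hi : i ≤ φ.half) :
    ∀ v ∈ { φ.baseRegs with pow := (2 ^ i : ℕ), var := φ.n - 2 * i : SatRegs }.toList,
      v.natAbs ≤ φ.bound := by
  have hbound := φ.four_mul_vecCost_le_bound
  have hn := φ.n_lt_vecCost
  have hm := φ.length_clauses_lt_vecCost
  have hlen := φ.fits.input_length
  have hpow : 2 ^ i ≤ 2 ^ φ.half := Nat.pow_le_pow_right two_pos hi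
  have hpow' := φ.two_mul_two_pow_half_le_bound
  have hhalf : φ.half = (φ.n + 1) / 2 := rfl
  simp only [SatRegs.toList, baseRegs, List.forall_mem_cons, List.not_mem_nil, IsEmpty.forall_iff,
    implies_true, and_true]
  generalize 2 ^ i = y at *
  generalize 2 ^ φ.half = z at *
  omega

theorem natAbs_le_of_mem_vecRegs {A : ℕ} (hA : A ≤ 2 * 2 ^ φ.half) :
    ∀ v ∈ (φ.vecRegs A).toList, v.natAbs ≤ φ.bound := by
  have hbound := φ.four_mul_vecCost_le_bound
  have hn := φ.n_lt_vecCost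
  have hm := φ.length_clauses_lt_vecCost
  have hlen := φ.fits.input_length
  have hpow := φ.two_mul_two_pow_half_le_bound
  simp only [SatRegs.toList, vecRegs, baseRegs, List.forall_mem_cons, List.not_mem_nil,
    IsEmpty.forall_iff, implies_true, and_true]
  generalize 2 ^ φ.half = z at *
  omega

theorem natAbs_le_of_mem_clauseRegs {A j : ℕ} (hA : A ≤ 2 * 2 ^ φ.half)
    (hj : j ≤ φ.clauses.length) : ∀ v ∈ (φ.clauseRegs A j).toList, v.natAbs ≤ φ.bound := by
  have hbound := φ.four_mul_vecCost_le_bound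
  have hm := φ.length_clauses_lt_vecCost
  have hpos := (φ.pos_le j).trans φ.fits.input_length
  have hpow := φ.two_mul_two_pow_half_le_bound
  have hside : A / 2 ^ φ.half ≤ A := Nat.div_le_self _ _
  have hasg : A % 2 ^ φ.half ≤ A := Nat.mod_le _ _
  have hvec := φ.natAbs_le_of_mem_vecRegs hA
  simp only [SatRegs.toList, clauseRegs, List.forall_mem_cons, List.not_mem_nil,
    IsEmpty.forall_iff, implies_true, and_true, Int.natAbs_natCast] at hvec ⊢
  generalize A / 2 ^ φ.half = x at *
  generalize A % 2 ^ φ.half = y at *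
  generalize 2 ^ φ.half = z at *
  obtain ⟨hvars, hclauses, hinput, hvec, hpow, -, -, -, -, hrest⟩ := hvec
  refine ⟨hvars, hclauses, hinput, hvec, hpow, ?_, ?_, ?_, ?_, hrest⟩ <;> omega

theorem natAbs_le_of_mem_litRegs_with {A j t : ℕ} {var shifted sign : ℤ} (hA : A ≤ 2 * 2 ^ φ.half)
    (hj : j < φ.clauses.length) (ht : t ≤ φ.clauses[j].length) (hvar : var.natAbs ≤ φ.bound)
    (hshifted : shifted.natAbs ≤ φ.bound) (hsign : sign.natAbs ≤ φ.bound) :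
    ∀ v ∈ { φ.litRegs A hj t with var, shifted, sign }.toList, v.natAbs ≤ φ.bound := by
  have hpos := (φ.pos_le (j + 1)).trans φ.fits.input_length
  have hsucc := φ.pos_succ hj
  have hflag := Bool.toNat_le
    (unsatBy (A / 2 ^ φ.half) (A % 2 ^ φ.half) (φ.clauses[j].take t))
  have hone := φ.fits.one_le
  have hclause := φ.natAbs_le_of_mem_clauseRegs hA hj.le
  simp only [SatRegs.toList, litRegs, List.forall_mem_cons, List.not_mem_nil,
    IsEmpty.forall_iff, implies_true, and_true, Int.natAbs_natCast] at hclause ⊢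
  obtain ⟨hvars, hclauses, hinput, hvec, hpow, hside, hasg, hleft, -⟩ := hclause
  refine ⟨hvars, hclauses, hinput, hvec, hpow, hside, hasg, hleft, ?_, ?_, ?_, hvar, hshifted,
    hsign⟩ <;> omega

theorem natAbs_le_of_mem_litRegs {A j t : ℕ} (hA : A ≤ 2 * 2 ^ φ.half)
    (hj : j < φ.clauses.length) (ht : t ≤ φ.clauses[j].length) :
    ∀ v ∈ (φ.litRegs A hj t).toList, v.natAbs ≤ φ.bound :=
  φ.natAbs_le_of_mem_litRegs_with (var := 0) (shifted := 0) (sign := 0) hA hj ht φ.bound.zero_le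
    φ.bound.zero_le φ.bound.zero_le

end KCNF

theorem flatMap_range_nil {α : Type*} (k : ℕ) :
    ((List.range k).flatMap fun _ => ([] : List α)) = [] := by
  simp

theorem unsatBy_take_succ {n : ℕ} (side a : ℕ) (cl : List (Fin n × Bool)) {t : ℕ}
    (ht : t < cl.length) : unsatBy side a (cl.take (t + 1)) = (unsatBy side a (cl.take t) &&
      !(decide ((cl[t].1 : ℕ) % 2 = side) && a.testBit (cl[t].1 / 2) == cl[t].2)) := by
  rw [unsatBy, List.take_add_one, List.getElem?_eq_getElem ht, List.all_append, Option.toList_some,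
    List.all_cons, List.all_nil, Bool.and_true, unsatBy]

namespace KCNF

variable {k : ℕ} (φ : KCNF k)

section

variable {A j t : ℕ} (hA : A < 2 * 2 ^ φ.half) (hj : j < φ.clauses.length)
include hA

theorem writes_satReadLit (ht : t < φ.clauses[j].length) :
    Writes φ.bound 1 φ.encode φ.toOV.encode satReadLit (φ.litRegs A hj t).toList
      { φ.litRegs A hj t with
        var := φ.clauses[j][t].1, shifted := (A % 2 ^ φ.half : ℕ)
        sign := φ.clauses[j][t].2.toNat }.toList [] := by
  refine .block φ.fits isBlock_satReadLit (φ.natAbs_le_of_mem_litRegs hA.le hj ht.le) fun o ω => ?_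
  rw [List.append_nil, eval_satReadLit o ω rfl (φ.padded_encode_pos_add_one_add hj ht)]
  rfl

theorem writes_satHalve_loop (ht : t ≤ φ.clauses[j].length) (i : Fin φ.n) (s : Bool) :
    Writes φ.bound (i / 2 + 1) φ.encode φ.toOV.encode (.loop (.sub (.reg 12) (.const 1)) satHalve)
      { φ.litRegs A hj t with
        var := i, shifted := (A % 2 ^ φ.half : ℕ), sign := s.toNat }.toList
      { φ.litRegs A hj t with
        var := (i % 2 : ℕ), shifted := (A % 2 ^ φ.half / 2 ^ (i / 2 : ℕ) : ℕ)
        sign := s.toNat }.toList [] := by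
  let st (q : ℕ) : SatRegs := { φ.litRegs A hj t with
    var := i - 2 * q, shifted := (A % 2 ^ φ.half / 2 ^ q : ℕ), sign := s.toNat }
  have hone := φ.fits.one_le
  have hsmall : ∀ q ≤ (i / 2 : ℕ), ∀ v ∈ (st q).toList, v.natAbs ≤ φ.bound := fun q hq => by
    have hn := φ.n_lt_vecCost
    have hbound := φ.four_mul_vecCost_le_bound
    have hs := Bool.toNat_le s
    refine φ.natAbs_le_of_mem_litRegs_with hA.le hj ht (by omega) ?_ (by omega)
    exact (Nat.div_le_self _ _).trans ((Nat.mod_le _ _).trans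
      (hA.le.trans φ.two_mul_two_pow_half_le_bound))
  have hstep : ∀ q, ∀ o ω, satHalve.eval (outState (st q).toList φ.encode o ω)
      = outState (st (q + 1)).toList φ.encode (o ++ []) ω := fun q o ω => by
    rw [List.append_nil, eval_satHalve]
    simp only [st, pow_succ, ← Nat.div_div_eq_div_mul]
    push_cast
    rw [mul_add, mul_one, sub_sub]
  have hloop := Writes.loop φ.fits le_rfl (e := .sub (.reg 12) (.const 1))
    (p := satHalve) (fun q => (st q).toList)
    (fun _ => []) (i / 2) hsmall
    (fun q hq o ω => by
      have hlt : (1 : ℤ) < (i : ℕ) - 2 * q := by omega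
      simpa [Expr.val, SatRegs.toList, st] using hlt)
    (fun o ω => by
      have hle : ((i : ℕ) : ℤ) ≤ 1 + 2 * ((i : ℕ) / 2) := by omega
      simpa [Expr.val, SatRegs.toList, st] using hle)
    fun q hq => .block φ.fits ⟨trivial, trivial⟩ (hsmall q hq.le) (hstep q)
  have hend : ((i : ℕ) : ℤ) - 2 * ((i / 2 : ℕ) : ℤ) = (i % 2 : ℕ) := by omega
  simpa only [mul_one, st, hend, Nat.cast_zero, mul_zero, sub_zero, pow_zero, Nat.div_one,
    flatMap_range_nil] using hloop

theorem writes_satUseLit (ht : t < φ.clauses[j].length) :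
    Writes φ.bound 1 φ.encode φ.toOV.encode satUseLit
      { φ.litRegs A hj t with
        var := (φ.clauses[j][t].1 % 2 : ℕ)
        shifted := (A % 2 ^ φ.half / 2 ^ (φ.clauses[j][t].1 / 2 : ℕ) : ℕ)
        sign := φ.clauses[j][t].2.toNat }.toList
      (φ.litRegs A hj (t + 1)).toList [] := by
  have hs := Bool.toNat_le φ.clauses[j][t].2
  have hone := φ.fits.one_le
  refine .block φ.fits isBlock_satUseLit
    (φ.natAbs_le_of_mem_litRegs_with hA.le hj ht.le (by omega) ?_ (by omega)) fun o ω => ?_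
  · exact (Nat.div_le_self _ _).trans ((Nat.mod_le _ _).trans
      (hA.le.trans φ.two_mul_two_pow_half_le_bound))
  · rw [List.append_nil, eval_satUseLit _ o ω rfl rfl rfl (Nat.div_lt_of_lt_mul (by omega)) rfl rfl,
      ← Nat.testBit_eq_decide_div_mod_eq, ← unsatBy_take_succ _ _ _ ht]
    congr 2
    simp only [litRegs, SatRegs.mk.injEq, true_and]
    push_cast
    exact ⟨by ring, by ring, rfl, rfl, rfl⟩

theorem writes_satLit (ht : t < φ.clauses[j].length) :
    Writes φ.bound (φ.n + 1) φ.encode φ.toOV.encode satLit (φ.litRegs A hj t).toList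
      (φ.litRegs A hj (t + 1)).toList [] :=
  ((φ.writes_satReadLit hA hj ht).mono (by omega)).seq
    (((φ.writes_satHalve_loop hA hj ht.le φ.clauses[j][t].1 φ.clauses[j][t].2).mono
      (by omega)).seq ((φ.writes_satUseLit hA hj ht).mono (by omega)))

theorem writes_satClauseStart : Writes φ.bound 1 φ.encode φ.toOV.encode satClauseStart
    (φ.clauseRegs A j).toList (φ.litRegs A hj 0).toList [] := by
  refine .block φ.fits ⟨trivial, trivial, trivial⟩ (φ.natAbs_le_of_mem_clauseRegs hA.le hj.le)
    fun o ω => ?_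
  rw [List.append_nil, eval_satClauseStart _ o ω rfl, φ.padded_encode_pos hj]
  simp [litRegs, clauseRegs, unsatBy]

theorem writes_satLit_loop : Writes φ.bound ((φ.clauses[j].length + 1) * (φ.n + 1)) φ.encode
    φ.toOV.encode (.loop (.reg 11) satLit) (φ.litRegs A hj 0).toList
    (φ.litRegs A hj φ.clauses[j].length).toList [] := by
  have hloop := Writes.loop φ.fits (by omega) (e := .reg 11) (fun t => (φ.litRegs A hj t).toList)
    (fun _ => []) φ.clauses[j].length
    (fun t ht => φ.natAbs_le_of_mem_litRegs hA.le hj ht)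
    (fun t ht o ω => by simpa [Expr.val, SatRegs.toList, litRegs] using ht)
    (fun o ω => by simp [Expr.val, SatRegs.toList, litRegs])
    fun t ht => φ.writes_satLit hA hj ht
  simpa only [flatMap_range_nil] using hloop

theorem writes_satClauseEnd : Writes φ.bound 1 φ.encode φ.toOV.encode satClauseEnd
    (φ.litRegs A hj φ.clauses[j].length).toList (φ.clauseRegs A (j + 1)).toList
    [((φ.toOV.bit A j).toNat : ℤ)] := by
  refine .block φ.fits isBlock_satClauseEnd
    (φ.natAbs_le_of_mem_litRegs hA.le hj le_rfl) fun o ω => ?_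
  rw [eval_satClauseEnd, φ.bit_toOV hA hj]
  simp [litRegs, clauseRegs, φ.pos_succ hj, sub_sub, vecRegs, baseRegs]

include hj in
theorem writes_satClause : Writes φ.bound ((k + 1) * (φ.n + 1)) φ.encode φ.toOV.encode satClause
    (φ.clauseRegs A j).toList (φ.clauseRegs A (j + 1)).toList [((φ.toOV.bit A j).toNat : ℤ)] := by
  have hone : 1 ≤ (k + 1) * (φ.n + 1) := Nat.mul_pos k.succ_pos φ.n.succ_pos
  have hlen := φ.size_le _ (List.getElem_mem hj)
  exact ((φ.writes_satClauseStart hA hj).mono hone).seq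
    (((φ.writes_satLit_loop hA hj).mono (by gcongr)).seq
      ((φ.writes_satClauseEnd hA hj).mono hone))

end

theorem writes_satClause_loop {A : ℕ} (hA : A < 2 * 2 ^ φ.half) :
    Writes φ.bound φ.vecCost φ.encode φ.toOV.encode (.loop (.reg 8) satClause)
      (φ.clauseRegs A 0).toList (φ.clauseRegs A φ.clauses.length).toList
      ((List.range φ.clauses.length).flatMap fun j => [((φ.toOV.bit A j).toNat : ℤ)]) :=
  Writes.loop φ.fits (Nat.mul_pos k.succ_pos φ.n.succ_pos) (fun j => (φ.clauseRegs A j).toList) _ _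
    (fun j hj => φ.natAbs_le_of_mem_clauseRegs hA.le hj)
    (fun j hj o ω => by simpa [Expr.val, SatRegs.toList, clauseRegs] using hj)
    (fun o ω => by simp [Expr.val, SatRegs.toList, clauseRegs])
    fun j hj => φ.writes_satClause hA hj

theorem writes_satVec {A : ℕ} (hA : A < 2 * 2 ^ φ.half) :
    Writes φ.bound φ.vecCost φ.encode φ.toOV.encode satVec (φ.vecRegs A).toList
      (φ.vecRegs (A + 1)).toList
      ((List.range φ.toOV.d).map fun j => ((φ.toOV.bit A j).toNat : ℤ)) := by
  have hcost : 1 ≤ φ.vecCost := Nat.one_le_of_lt φ.n_lt_vecCost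
  have hstart : Writes φ.bound 1 φ.encode φ.toOV.encode satVecStart (φ.vecRegs A).toList
      (φ.clauseRegs A 0).toList [] := by
    refine .block φ.fits ⟨trivial, trivial, trivial, trivial⟩ (φ.natAbs_le_of_mem_vecRegs hA.le)
      fun o ω => ?_
    rw [List.append_nil, eval_satVecStart]
    simp [clauseRegs, vecRegs, baseRegs, φ.pos_zero]
  have hend : Writes φ.bound 1 φ.encode φ.toOV.encode satVecEnd
      (φ.clauseRegs A φ.clauses.length).toList (φ.vecRegs (A + 1)).toList [0] := by
    refine .block φ.fits isBlock_satVecEnd (φ.natAbs_le_of_mem_clauseRegs hA.le le_rfl)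
      fun o ω => ?_
    rw [eval_satVecEnd]
    simp [clauseRegs, vecRegs, baseRegs]
  have hcode : ((List.range φ.toOV.d).map fun j => ((φ.toOV.bit A j).toNat : ℤ)) =
      ((List.range φ.clauses.length).flatMap fun j => [((φ.toOV.bit A j).toNat : ℤ)]) ++ [0] := by
    rw [show φ.toOV.d = φ.clauses.length + 1 from rfl, List.range_succ, List.map_append,
      List.map_singleton, φ.bit_toOV_last, List.map_eq_flatMap]
    rfl
  rw [hcode]
  exact (hstart.mono hcost).seq ((φ.writes_satClause_loop hA).seq (hend.mono hcost))

/-- The numbers that precede the vectors in the instance of Orthogonal Vectors. -/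
def ovHead : List ℤ := [(2 ^ φ.half : ℕ), φ.clauses.length + 1]

theorem writes_satHead : Writes φ.bound (φ.half + 1) φ.encode φ.toOV.encode
    (.seq satPowStart (.seq (.loop (.reg 12) satDouble) satWriteHead)) φ.baseRegs.toList
    (φ.vecRegs 0).toList φ.ovHead := by
  let st (i : ℕ) : SatRegs := { φ.baseRegs with pow := (2 ^ i : ℕ), var := φ.n - 2 * i }
  have hhalf : φ.half = (φ.n + 1) / 2 := rfl
  have hstart : Writes φ.bound 1 φ.encode φ.toOV.encode satPowStart φ.baseRegs.toList
      (st 0).toList [] := by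
    refine .block φ.fits ⟨trivial, trivial⟩ φ.natAbs_le_of_mem_baseRegs fun o ω => ?_
    rw [List.append_nil, eval_satPowStart]
    simp [st, baseRegs]
  have hstep : ∀ i, ∀ o ω, satDouble.eval (outState (st i).toList φ.encode o ω)
      = outState (st (i + 1)).toList φ.encode (o ++ []) ω := fun i o ω => by
    rw [List.append_nil, eval_satDouble]
    simp only [st, pow_succ]
    push_cast
    rw [mul_add, mul_one, sub_sub]
  have hloop : Writes φ.bound ((φ.half + 1) * 1) φ.encode φ.toOV.encode (.loop (.reg 12) satDouble)
      (st 0).toList (st φ.half).toList ((List.range φ.half).flatMap fun _ => []) :=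
    Writes.loop φ.fits le_rfl (fun i => (st i).toList) _ _
      (fun i hi => φ.natAbs_le_of_mem_powRegs hi)
      (fun i hi o ω => by
        have hlt : 2 * (i : ℤ) < φ.n := by omega
        simpa [Expr.val, SatRegs.toList, st] using hlt)
      (fun o ω => by
        have hle : (φ.n : ℤ) ≤ 2 * φ.half := by omega
        simpa [Expr.val, SatRegs.toList, st] using hle)
      fun i hi => .block φ.fits ⟨trivial, trivial⟩ (φ.natAbs_le_of_mem_powRegs hi.le) (hstep i)
  have hwrite : Writes φ.bound 1 φ.encode φ.toOV.encode satWriteHead (st φ.half).toList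
      (φ.vecRegs 0).toList φ.ovHead :=
    .block φ.fits isBlock_satWriteHead (φ.natAbs_le_of_mem_powRegs le_rfl) fun o ω =>
      eval_satWriteHead _ _ _ _
  rw [mul_one, flatMap_range_nil] at hloop
  exact (hstart.mono (by omega)).seq (hloop.seq (hwrite.mono (by omega)))

theorem writes_satWriteOV : Writes φ.bound φ.bound φ.encode φ.toOV.encode satWriteOV
    φ.baseRegs.toList (φ.vecRegs (2 * 2 ^ φ.half)).toList φ.toOV.encode := by
  have hcost : 1 ≤ φ.vecCost := Nat.one_le_of_lt φ.n_lt_vecCost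
  have hpow : 1 ≤ 2 ^ φ.half := Nat.one_le_two_pow
  have hhead : φ.half + 1 ≤ φ.bound := by
    have hlt : φ.half < 2 ^ φ.half := Nat.lt_two_pow_self
    have := φ.two_mul_two_pow_half_le_bound
    omega
  have hloop : (2 * 2 ^ φ.half + 1) * φ.vecCost ≤ φ.bound := by
    rw [bound, ← mul_assoc]
    exact Nat.mul_le_mul_right _ (by omega)
  have hvecs := Writes.loop φ.fits hcost (e := .sub (.add (.reg 5) (.reg 5)) (.reg 4))
    (fun A => (φ.vecRegs A).toList) _ (2 * 2 ^ φ.half)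
    (fun A hA => φ.natAbs_le_of_mem_vecRegs hA)
    (fun A hA o ω => by
      rw [two_mul] at hA
      simpa [Expr.val, SatRegs.toList, vecRegs] using mod_cast hA)
    (fun o ω => by simp [Expr.val, SatRegs.toList, vecRegs, two_mul])
    fun A hA => φ.writes_satVec hA
  have hwrite := (φ.writes_satHead.mono hhead).seq (hvecs.mono hloop)
  have hcode : φ.toOV.encode = φ.ovHead ++ (List.range (2 * 2 ^ φ.half)).flatMap fun A =>
      (List.range φ.toOV.d).map fun j => ((φ.toOV.bit A j).toNat : ℤ) := by
    rw [φ.toOV.encode_eq, two_mul]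
    rfl
  rwa [← hcode] at hwrite

theorem runs_satSetup (ω : ℕ → Bool) : Runs φ.bound (φ.clauses.length + 1) satSetup
    (initState φ.encode ω) (tapeState (0 :: φ.baseRegs.toList) 0 (padded φ.encode) ω) := by
  let st (j : ℕ) : SatRegs := { vars := φ.n, clauses := φ.clauses.length, inputLength := φ.pos j
                                clausesLeft := φ.clauses.length - j }
  have hone := φ.fits.one_le
  have hinput := natAbs_padded_le φ.fits.input
  have hread : Runs φ.bound 1 satReadSizes (initState φ.encode ω)
      (tapeState (0 :: (st 0).toList) 0 (padded φ.encode) ω) := by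
    rw [initState_eq_tapeState, ← tapeState_replicate_zero 15]
    refine .block ⟨trivial, trivial, trivial, trivial⟩ hone
      (.tapeState (by simp) (by simp) hinput ω) ?_
    refine (eval_satReadSizes ω (padded φ.encode)).trans ?_
    simp [st, φ.pos_zero, encode_eq, padded]
  have hsmall : ∀ j ≤ φ.clauses.length,
      Small φ.bound (tapeState (0 :: (st j).toList) 0 (padded φ.encode) ω) := fun j hj => by
    refine .tapeState ?_ (by simp) hinput ω
    have hpos := (φ.pos_le j).trans φ.fits.input_length
    have hbase := φ.natAbs_le_of_mem_baseRegs
    simp only [SatRegs.toList, st, baseRegs, List.forall_mem_cons, List.not_mem_nil,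
      IsEmpty.forall_iff, implies_true, and_true] at hbase ⊢
    omega
  have hskip := Runs.loop (e := .reg 8) (p := satSkipClause) hone le_rfl
    (fun j => tapeState (0 :: (st j).toList) 0 (padded φ.encode) ω) φ.clauses.length
    (fun j hj => by simpa [Expr.val, SatRegs.toList, st] using hj)
    (by simp [Expr.val, SatRegs.toList, st]) hsmall
    fun j hj => .block ⟨trivial, trivial⟩ hone (hsmall j hj.le) (by
      rw [eval_satSkipClause ω rfl, φ.padded_encode_pos hj]
      simp [st, φ.pos_succ hj, sub_sub, add_assoc])
  have hend : st φ.clauses.length = φ.baseRegs := by simp [st, baseRegs, φ.pos_length]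
  rw [hend, mul_one] at hskip
  exact (hread.mono (by omega)).seq hskip

theorem runs_toOV (ω : ℕ → Bool) : Runs φ.bound φ.bound (transduce 15 satSetup satWriteOV)
    (initState φ.encode ω) (initState φ.toOV.encode ω) := by
  have hbound := φ.four_mul_vecCost_le_bound
  have hn := φ.n_lt_vecCost
  have hm := φ.length_clauses_lt_vecCost
  have hlen := φ.length_encode_le_vecCost
  have hvecs := φ.natAbs_le_of_mem_vecRegs le_rfl
  refine Runs.transduce φ.fits (a := φ.n) (b := φ.clauses.length) (l := List.replicate 10 0)
    (by omega) (by simpa using ⟨by omega, by omega⟩) ?_ ?_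
    ((φ.runs_satSetup ω).mono (by omega)) φ.writes_satWriteOV
  · simp only [SatRegs.toList, List.forall_mem_cons] at hvecs ⊢
    exact ⟨hvecs.1, hvecs.2.1, hvecs.2.2.2⟩
  · simp

end KCNF

/-! ### Running time of the reduction to Orthogonal Vectors -/

theorem exists_pow_le_mul_two_rpow (p : ℕ) {δ : ℝ} (hδ : 0 < δ) :
    ∃ G : ℝ, ∀ n : ℕ, ((n : ℝ) + 1) ^ p ≤ G * (2 : ℝ) ^ (δ * n) := by
  have hr : (1 : ℝ) < 2 ^ δ := Real.one_lt_rpow (by norm_num) hδ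
  obtain ⟨G, hG⟩ := (tendsto_pow_const_div_const_pow_of_one_lt p hr).bddAbove_range
  have hratio : ∀ n : ℕ, (n : ℝ) ^ p / ((2 : ℝ) ^ δ) ^ n ≤ G := fun n => hG ⟨n, rfl⟩
  refine ⟨G * 2 ^ δ, fun n => ?_⟩
  calc ((n : ℝ) + 1) ^ p = ((n + 1 : ℕ) : ℝ) ^ p := by rw [Nat.cast_add_one]
    _ ≤ G * ((2 : ℝ) ^ δ) ^ (n + 1) := (div_le_iff₀ (by positivity)).1 (hratio (n + 1))
    _ = G * 2 ^ δ * (2 : ℝ) ^ (δ * n) := by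
      rw [Real.rpow_mul (by norm_num), Real.rpow_natCast, pow_succ]
      ring

theorem two_rpow_le_two_mul {x y : ℝ} (h : x ≤ y + 1) : (2 : ℝ) ^ x ≤ 2 * 2 ^ y := by
  calc (2 : ℝ) ^ x ≤ 2 ^ (y + 1) := Real.rpow_le_rpow_of_exponent_le (by norm_num) h
    _ = 2 * 2 ^ y := by rw [Real.rpow_add_one (by norm_num), mul_comm]

namespace KCNF

variable {k : ℕ} (φ : KCNF k)

theorem size_bound_le : φ.bound.size ≤ 3 * φ.vecCost := by
  have hn := φ.n_lt_vecCost
  have hhalf : φ.half = (φ.n + 1) / 2 := rfl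
  have hlt : φ.bound < 2 ^ (2 + φ.half + φ.vecCost) := by
    rw [pow_add, pow_add, mul_assoc]
    exact Nat.mul_lt_mul_of_pos_left
      (Nat.mul_lt_mul_of_pos_left Nat.lt_two_pow_self (by positivity)) (by norm_num)
  exact (Nat.size_le.2 hlt).trans (by omega)

theorem length_clauses_add_one_le :
    φ.clauses.length + 1 ≤ 2 ^ (k + 1) * (φ.n + 1) ^ k := by
  have hone : 1 ≤ 2 ^ k * (φ.n + 1) ^ k := Nat.mul_pos (by positivity) (by positivity)
  calc φ.clauses.length + 1 ≤ (2 * φ.n + 1) ^ k + 1 := by gcongr; exact φ.length_clauses_le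
    _ ≤ (2 * (φ.n + 1)) ^ k + 1 := by gcongr; omega
    _ = 2 ^ k * (φ.n + 1) ^ k + 1 := by rw [mul_pow]
    _ ≤ 2 ^ k * (φ.n + 1) ^ k + 2 ^ k * (φ.n + 1) ^ k := by gcongr
    _ = 2 ^ (k + 1) * (φ.n + 1) ^ k := by ring

theorem vecCost_le : φ.vecCost ≤ 2 ^ (k + 1) * (k + 1) * (φ.n + 1) ^ (k + 1) := by
  calc φ.vecCost ≤ 2 ^ (k + 1) * (φ.n + 1) ^ k * ((k + 1) * (φ.n + 1)) :=
        Nat.mul_le_mul_right _ φ.length_clauses_add_one_le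
    _ = 2 ^ (k + 1) * (k + 1) * (φ.n + 1) ^ (k + 1) := by ring

theorem one_le_cast_vecCost : (1 : ℝ) ≤ φ.vecCost := by
  exact_mod_cast Nat.one_le_of_lt φ.n_lt_vecCost

theorem two_pow_half_rpow_le {α β : ℝ} (hα : 0 ≤ α) (hα' : α ≤ 2) (hβ : α / 2 ≤ β) :
    ((2 ^ φ.half : ℕ) : ℝ) ^ α ≤ 2 * 2 ^ (β * φ.n) := by
  have hhalf : (φ.half : ℝ) ≤ (φ.n + 1) / 2 := by
    rw [le_div_iff₀ two_pos]
    exact_mod_cast Nat.div_mul_le_self _ _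
  rw [Nat.cast_pow, Nat.cast_ofNat, ← Real.rpow_natCast, ← Real.rpow_mul (by norm_num)]
  refine two_rpow_le_two_mul ?_
  calc (φ.half : ℝ) * α ≤ (φ.n + 1) / 2 * α := by gcongr
    _ = α / 2 * φ.n + α / 2 := by ring
    _ ≤ β * φ.n + 1 := by gcongr; linarith

theorem reduction_time_le {ε : ℝ} (hε : ε ≤ 1) (c : ℕ) : (φ.bound : ℝ) * φ.bound.size
    ≤ 24 * (φ.vecCost : ℝ) ^ (c + 2) * 2 ^ ((1 - ε / 2) * φ.n) := by
  have hsize : (φ.bound.size : ℝ) ≤ 3 * φ.vecCost := by exact_mod_cast φ.size_bound_le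
  have hpow := φ.two_pow_half_rpow_le (α := 1) (β := 1 - ε / 2) (by norm_num) (by norm_num)
    (by linarith)
  rw [Real.rpow_one] at hpow
  calc (φ.bound : ℝ) * φ.bound.size
      = 4 * ((2 ^ φ.half : ℕ) * φ.vecCost) * φ.bound.size := by
        rw [bound, Nat.cast_mul, Nat.cast_mul, Nat.cast_ofNat]
    _ ≤ 4 * (2 * 2 ^ ((1 - ε / 2) * φ.n) * φ.vecCost) * (3 * φ.vecCost) := by gcongr
    _ = 24 * (φ.vecCost : ℝ) ^ 2 * 2 ^ ((1 - ε / 2) * φ.n) := by ring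
    _ ≤ 24 * (φ.vecCost : ℝ) ^ (c + 2) * 2 ^ ((1 - ε / 2) * φ.n) := by
      gcongr
      · exact φ.one_le_cast_vecCost
      · omega

theorem ov_time_le {ε : ℝ} (hε : 0 ≤ ε) (hε' : ε ≤ 1) (c : ℕ) :
    (φ.toOV.n : ℝ) ^ (2 - ε) * (φ.toOV.d : ℝ) ^ c
      ≤ 2 * (φ.vecCost : ℝ) ^ (c + 2) * 2 ^ ((1 - ε / 2) * φ.n) := by
  have hd : (φ.toOV.d : ℝ) ≤ φ.vecCost := by exact_mod_cast φ.length_clauses_lt_vecCost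
  calc (φ.toOV.n : ℝ) ^ (2 - ε) * (φ.toOV.d : ℝ) ^ c
      ≤ 2 * 2 ^ ((1 - ε / 2) * φ.n) * (φ.vecCost : ℝ) ^ c := by
        gcongr
        exact φ.two_pow_half_rpow_le (by linarith) (by linarith) (by linarith)
    _ = 2 * (φ.vecCost : ℝ) ^ c * 2 ^ ((1 - ε / 2) * φ.n) := by ring
    _ ≤ 2 * (φ.vecCost : ℝ) ^ (c + 2) * 2 ^ ((1 - ε / 2) * φ.n) := by
      gcongr
      · exact φ.one_le_cast_vecCost
      · omega

end KCNF

theorem exists_vecCost_pow_le (k p : ℕ) {δ : ℝ} (hδ : 0 < δ) :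
    ∃ G : ℝ, ∀ φ : KCNF k, (φ.vecCost : ℝ) ^ p ≤ G * 2 ^ (δ * φ.n) := by
  obtain ⟨G, hG⟩ := exists_pow_le_mul_two_rpow ((k + 1) * p) hδ
  refine ⟨(2 ^ (k + 1) * (k + 1)) ^ p * G, fun φ => ?_⟩
  have hcost : (φ.vecCost : ℝ) ≤ 2 ^ (k + 1) * (k + 1) * ((φ.n : ℝ) + 1) ^ (k + 1) := by
    exact_mod_cast φ.vecCost_le
  calc (φ.vecCost : ℝ) ^ p
      ≤ (2 ^ (k + 1) * (k + 1) * ((φ.n : ℝ) + 1) ^ (k + 1)) ^ p := by gcongr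
    _ = (2 ^ (k + 1) * (k + 1)) ^ p * ((φ.n : ℝ) + 1) ^ ((k + 1) * p) := by
      rw [mul_pow _ (((φ.n : ℝ) + 1) ^ (k + 1)), ← pow_mul]
    _ ≤ (2 ^ (k + 1) * (k + 1)) ^ p * (G * 2 ^ (δ * φ.n)) := by
      gcongr
      exact hG φ.n
    _ = (2 ^ (k + 1) * (k + 1)) ^ p * G * 2 ^ (δ * φ.n) := by rw [mul_assoc]

theorem ksat_solvable_of_ov {ε C : ℝ} {c : ℕ} (hε : 0 < ε) (hε' : ε ≤ 1) (hC : 0 ≤ C)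
    (h : OV.SolvableInTime fun I : OVInstance => C * (I.n : ℝ) ^ (2 - ε) * (I.d : ℝ) ^ c) (k : ℕ) :
    ∃ C' : ℝ, (KSAT k).SolvableInTime fun φ : KCNF k => C' * (2 : ℝ) ^ ((1 - ε / 4) * φ.n) := by
  let R := transduce 15 satSetup satWriteOV
  obtain ⟨G, hG⟩ := exists_vecCost_pow_le k (c + 2) (δ := ε / 4) (by positivity)
  refine ⟨(24 * R.weight + 2 * C) * G, (h.of_reduction (P := KSAT k) KCNF.toOV
    KCNF.toOV_isYes_iff KCNF.runs_toOV).mono fun φ : KCNF k => ?_⟩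
  have hR := φ.reduction_time_le hε' c
  have hOV := φ.ov_time_le hε.le hε' c
  have hexp : (2 : ℝ) ^ (ε / 4 * φ.n) * 2 ^ ((1 - ε / 2) * φ.n) = 2 ^ ((1 - ε / 4) * φ.n) := by
    rw [← Real.rpow_add two_pos]
    congr 1
    ring
  calc (R.weight : ℝ) * (φ.bound * φ.bound.size) + C * (φ.toOV.n : ℝ) ^ (2 - ε) * (φ.toOV.d : ℝ) ^ c
      = R.weight * (φ.bound * φ.bound.size)
        + C * ((φ.toOV.n : ℝ) ^ (2 - ε) * (φ.toOV.d : ℝ) ^ c) := by ring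
    _ ≤ R.weight * (24 * (φ.vecCost : ℝ) ^ (c + 2) * 2 ^ ((1 - ε / 2) * φ.n))
        + C * (2 * (φ.vecCost : ℝ) ^ (c + 2) * 2 ^ ((1 - ε / 2) * φ.n)) := by gcongr
    _ = (24 * R.weight + 2 * C) * (φ.vecCost : ℝ) ^ (c + 2) * 2 ^ ((1 - ε / 2) * φ.n) := by ring
    _ ≤ (24 * R.weight + 2 * C) * (G * 2 ^ (ε / 4 * φ.n)) * 2 ^ ((1 - ε / 2) * φ.n) := by
      gcongr
      exact hG φ
    _ = (24 * R.weight + 2 * C) * G * (2 ^ (ε / 4 * φ.n) * 2 ^ ((1 - ε / 2) * φ.n)) := by ring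
    _ = (24 * R.weight + 2 * C) * G * 2 ^ ((1 - ε / 4) * φ.n) := by rw [hexp]

end FineGrained

/-- If `2`-sparse linear regression in the Euclidean norm, with a `d × n` design matrix, is solved
in time `n ^ (2 - ε) * poly(d)` for some `ε > 0`, even with a further factor polynomial in the bit
length of the numbers, then the Orthogonal Vectors Hypothesis and SETH are false. -/
theorem mainTheorem5
    (h : ∃ ε : ℝ, 0 < ε ∧ ∃ (C : ℝ) (c : ℕ),
      (FineGrained.SLR 2).SolvableInTime fun I : FineGrained.SLRInstance =>
        C * (I.n : ℝ) ^ (2 - ε) * ((I.d : ℝ) * (I.bits : ℝ)) ^ c) :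
    ¬ FineGrained.OVHypothesis ∧ ¬ FineGrained.SETH := by
  obtain ⟨ε, hε, C, c, h⟩ := h
  obtain ⟨ε', hε', hε1, C', c', hC', hOV⟩ := FineGrained.ov_solvable_of_slr hε h
  refine ⟨fun hyp => hyp ⟨ε', hε', C', c', hOV⟩, fun seth => ?_⟩
  obtain ⟨k, -, hk⟩ := seth (ε' / 4) (by positivity)
  exact hk (FineGrained.ksat_solvable_of_ov hε' hε1 hC' hOV k)
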